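/- Let $H$ be a real Hilbert space and $A:D(A)\to H$ a positive self-adjoint operator with compact inverse, let $0<\lambda_1\le\lambda_2\le\cdots$ be its eigenvalues repeated according to multiplicity, and let $\{e_n\}_{n\ge1}$ be a corresponding complete orthonormal system of eigenvectors in $H$. For $s\in\{1,-1\}$ put $\|u\|_{H^s}^2=\sum_n\lambda_n^s(u,e_n)^2$, let $H^1=D(A^{1/2})$, and let $P_NH$ be the span of $e_1,\dots,e_N$. For $\varepsilon\ge0$ and a globally Lipschitz $F:H\to H$ consider the equation $$\varepsilon\,\partial_t^2u+\partial_tu+Au=F(u).\qquad(*)$$ For $\varepsilon>0$ its solution semigroup $S(t)(u(0),\partial_tu(0))=(u(t),\partial_tu(t))$ acts on the phase space $\mathcal E=H^1\times H$ with norm $\|(u,v)\|_{\mathcal E}^2=\varepsilon\|v\|_H^2+\|v\|_{H^{-1}}^2+\|u\|_{H^1}^2$; for $\varepsilon=0$ its solution semigroup $S(t)u(0)=u(t)$ acts on the phase space $\mathcal E=H^1$ (a point $u\in H^1$ being identified with $(u,F(u)-Au)\in H^1\times H^{-1}$). An $N$-dimensional normally hyperbolic inertial manifold of $(*)$ is a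 set $\mathcal M\subset\mathcal E$ with the following properties. 1. $\mathcal M$ is the image of $P_NH$ under a locally Lipschitz closed topological embedding $P_NH\to\mathcal E$, and $S(t)\mathcal M=\mathcal M$ for all $t\ge0$. 2. There are $C,\theta>0$ such that for every $\xi_0\in\mathcal E$ there is $\bar\xi_0\in\mathcal M$ with $\|S(t)\xi_0-S(t)\bar\xi_0\|_{\mathcal E}\le C\|\xi_0\|_{\mathcal E}e^{-\theta t}$ for all $t\ge0$. 3. $\mathcal M$ is an $N$-dimensional embedded $C^1$ submanifold of $\mathcal E$, with tangent spaces $\mathcal T_\xi$, the maps $S(t)$ are Fréchet differentiable at the points of $\mathcal M$, and there are subspaces $\mathcal N_\xi$ ($\xi\in\mathcal M$) of codimension $N$ with $D_\xi S(t)\mathcal N_\xi\subset\mathcal N_{S(t)\xi}$ for $t\ge0$ and $\mathcal E=\mathcal T_\xi\oplus\mathcal N_\xi$, the two projectors of this splitting being bounded uniformly in $\xi\in\mathcal M$. 4. There are $C>0$ and $0<\kappa<\theta$ such that for all $\xi\in\mathcal M$ and $t\ge0$: $\|D_\xi S(t)\eta\|_{\mathcal E}\le Ce^{-(\theta+\kappa)t}\|\eta\|_{\mathcal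 E}$ for $\eta\in\mathcal N_\xi$, and $\|D_\xi S(t)\eta\|_{\mathcal E}\ge C^{-1}e^{-(\theta-\kappa)t}\|\eta\|_{\mathcal E}$ for $\eta\in\mathcal T_\xi$. **Theorem.** Let $\varepsilon\ge0$ and $L>0$ satisfy $$\sup\{\lambda_{N+1}-\lambda_N:\ N\ge1,\ 4\varepsilon\lambda_N<1\}<2L$$ (with $\sup\emptyset=-\infty$; for $\varepsilon=0$ the supremum is over all $N\ge1$) and $L>\lambda_1$. Then there is a map $F:H\to H$ of class $C^\infty$ with $F(0)=0$ and $\|F(u_1)-F(u_2)\|_H\le L\|u_1-u_2\|_H$ for all $u_1,u_2\in H$ such that equation $(*)$ has no $N$-dimensional normally hyperbolic inertial manifold for any $N\in\{0,1,2,\dots\}$. -/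

import Mathlib

namespace RelaxedIM

noncomputable section

/-- A positive self-adjoint operator `A : D(A) → H` with compact inverse in a real Hilbert space,
together with its eigenvalues in non-decreasing order (repeated according to multiplicity) and the
corresponding complete orthonormal system of eigenvectors. Indices start at `0`, so that
`eigenvalue n` is `λ_{n+1}` and `basis n` is `e_{n+1}` in the usual notation. -/
structure PosOp (H : Type*) [NormedAddCommGroup H] [InnerProductSpace ℝ H] [CompleteSpace H] where
  /-- the unbounded operator `A` -/
  op : H →ₗ.[ℝ] H
  selfAdjoint : IsSelfAdjoint op
  positive : ∀ x : op.domain, x ≠ 0 → 0 < inner ℝ (op x) (x : H)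
  compact_inverse : ∃ K : H →L[ℝ] H, IsCompactOperator K ∧
    (∀ y : H, ∃ h : K y ∈ op.domain, op ⟨K y, h⟩ = y) ∧ ∀ x : op.domain, K (op x) = x
  eigenvalue : ℕ → ℝ
  basis : HilbertBasis ℕ ℝ H
  eigen : ∀ n, ∃ h : basis n ∈ op.domain, op ⟨basis n, h⟩ = eigenvalue n • basis n
  eigenvalue_mono : Monotone eigenvalue

/-- The real sequence space `ℓ²`. -/
abbrev Seq2 : Type := lp (fun _ : ℕ => ℝ) 2

variable {H : Type*} [NormedAddCommGroup H] [InnerProductSpace ℝ H] [CompleteSpace H]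

namespace PosOp

variable (A : PosOp H)

theorem eigenvalue_pos (n : ℕ) : 0 < A.eigenvalue n := by
  obtain ⟨h, hn⟩ := A.eigen n
  have hb : ‖A.basis n‖ = 1 := A.basis.orthonormal.1 n
  have hne : (⟨A.basis n, h⟩ : A.op.domain) ≠ 0 := by
    intro h0
    have h1 : A.basis n = 0 := congrArg Subtype.val h0
    rw [h1, norm_zero] at hb
    exact zero_ne_one hb
  have hp := A.positive _ hne
  rw [hn, inner_smul_left, real_inner_self_eq_norm_sq, hb] at hp
  simpa using hp

/-- The `n`-th Fourier coefficient `(u, e_n)`. -/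
def coeff (n : ℕ) (u : H) : ℝ := inner ℝ (A.basis n) u

theorem coeff_add (n : ℕ) (u v : H) : A.coeff n (u + v) = A.coeff n u + A.coeff n v :=
  inner_add_right _ _ _

theorem coeff_smul (n : ℕ) (c : ℝ) (u : H) : A.coeff n (c • u) = c * A.coeff n u :=
  inner_smul_right _ _ _

theorem coeff_ext {u v : H} (h : ∀ n, A.coeff n u = A.coeff n v) : u = v := by
  apply A.basis.repr.injective
  ext n
  rw [A.basis.repr_apply_apply, A.basis.repr_apply_apply]
  exact h n

/-- `H¹ = D(A^{1/2})` as a subspace of `H`: the vectors with `∑ λ_n (u, e_n)² < ∞`. -/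
def H1sub : Submodule ℝ H where
  carrier := {u | Memℓp (fun n => √(A.eigenvalue n) * A.coeff n u) 2}
  zero_mem' := by
    have : (fun n => √(A.eigenvalue n) * A.coeff n (0 : H)) = 0 := by
      funext n
      simp [coeff]
    simp only [Set.mem_ofPred_eq, this]
    exact zero_memℓp
  add_mem' := by
    intro u v hu hv
    have : (fun n => √(A.eigenvalue n) * A.coeff n (u + v)) =
        (fun n => √(A.eigenvalue n) * A.coeff n u) +
          (fun n => √(A.eigenvalue n) * A.coeff n v) := by
      funext n
      simp [coeff_add, mul_add]
    simp only [Set.mem_ofPred_eq, this]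
    exact Memℓp.add hu hv
  smul_mem' := by
    intro c u hu
    have : (fun n => √(A.eigenvalue n) * A.coeff n (c • u)) =
        c • (fun n => √(A.eigenvalue n) * A.coeff n u) := by
      funext n
      simp only [coeff_smul, Pi.smul_apply, smul_eq_mul]
      ring
    simp only [Set.mem_ofPred_eq, this]
    exact Memℓp.const_smul hu c

/-- The space `H¹`; its norm (below) is `‖u‖_{H¹}² = ∑ λ_n (u, e_n)²`, not the norm of `H`. -/
def H1 : Type _ := A.H1sub

instance : AddCommGroup A.H1 := inferInstanceAs (AddCommGroup A.H1sub)
instance : Module ℝ A.H1 := inferInstanceAs (Module ℝ A.H1sub)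

/-- The inclusion `H¹ → H`. -/
def incl : A.H1 →ₗ[ℝ] H := A.H1sub.subtype

/-- `u ↦ A^{1/2} u` on `H¹`, in coordinates. -/
def sqrtCoord : A.H1 →ₗ[ℝ] Seq2 where
  toFun u := ⟨fun n => √(A.eigenvalue n) * A.coeff n (A.incl u), u.2⟩
  map_add' u v := by
    apply Subtype.ext
    funext n
    simp only [map_add, coeff_add, mul_add, lp.coeFn_add, Pi.add_apply]
  map_smul' c u := by
    apply Subtype.ext
    funext n
    simp only [map_smul, coeff_smul, lp.coeFn_smul, Pi.smul_apply, smul_eq_mul, RingHom.id_apply]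
    ring

theorem sqrtCoord_injective : Function.Injective A.sqrtCoord := by
  intro u v h
  apply Subtype.ext
  apply A.coeff_ext
  intro n
  have h1 : √(A.eigenvalue n) * A.coeff n (A.incl u) = √(A.eigenvalue n) * A.coeff n (A.incl v) :=
    congrArg (fun s : Seq2 => s n) h
  exact mul_left_cancel₀ (Real.sqrt_pos.2 (A.eigenvalue_pos n)).ne' h1

instance : NormedAddCommGroup A.H1 :=
  NormedAddCommGroup.induced A.H1 Seq2 A.sqrtCoord A.sqrtCoord_injective

instance : NormedSpace ℝ A.H1 := NormedSpace.induced ℝ A.H1 Seq2 A.sqrtCoord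

theorem Seq2_norm_sq (s : Seq2) : ‖s‖ ^ 2 = ∑' n, s n ^ 2 := by
  have h := lp.norm_rpow_eq_tsum (p := 2) (by norm_num) s
  simpa using h

theorem H1_norm_sq (u : A.H1) :
    ‖u‖ ^ 2 = ∑' n, A.eigenvalue n * A.coeff n (A.incl u) ^ 2 := by
  have h : ‖u‖ = ‖A.sqrtCoord u‖ := rfl
  rw [h, Seq2_norm_sq]
  refine tsum_congr fun n => ?_
  have h1 : A.sqrtCoord u n = √(A.eigenvalue n) * A.coeff n (A.incl u) := rfl
  rw [h1, mul_pow, Real.sq_sqrt (A.eigenvalue_pos n).le]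

theorem invSqrt_mem (v : H) : Memℓp (fun n => (√(A.eigenvalue n))⁻¹ * A.coeff n v) 2 := by
  have h0 : Memℓp (fun n => (√(A.eigenvalue 0))⁻¹ * A.coeff n v) 2 := by
    have h1 := Memℓp.const_smul (lp.memℓp (A.basis.repr v)) (√(A.eigenvalue 0))⁻¹
    have h2 : (fun n => (√(A.eigenvalue 0))⁻¹ * A.coeff n v) =
        (√(A.eigenvalue 0))⁻¹ • ((A.basis.repr v : lp (fun _ : ℕ => ℝ) 2) : ℕ → ℝ) := by
      funext n
      rw [Pi.smul_apply, A.basis.repr_apply_apply]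
      rfl
    rw [h2]
    exact h1
  refine (memℓp_gen_iff (by norm_num)).2 ?_
  have hs := (memℓp_gen_iff (by norm_num)).1 h0
  refine Summable.of_nonneg_of_le (fun n => by positivity) (fun n => ?_) hs
  refine Real.rpow_le_rpow (norm_nonneg _) ?_ (by norm_num)
  rw [norm_mul, norm_mul]
  refine mul_le_mul_of_nonneg_right ?_ (norm_nonneg _)
  rw [norm_inv, norm_inv, Real.norm_of_nonneg (Real.sqrt_nonneg _),
    Real.norm_of_nonneg (Real.sqrt_nonneg _)]
  exact inv_anti₀ (Real.sqrt_pos.2 (A.eigenvalue_pos 0))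
    (Real.sqrt_le_sqrt (A.eigenvalue_mono (Nat.zero_le n)))

/-- `v ↦ A^{-1/2} v` on `H`, in coordinates; `‖v‖_{H⁻¹}` is the `ℓ²` norm of its value. -/
def invSqrtCoord : H →ₗ[ℝ] Seq2 where
  toFun v := ⟨fun n => (√(A.eigenvalue n))⁻¹ * A.coeff n v, A.invSqrt_mem v⟩
  map_add' u v := by
    apply Subtype.ext
    funext n
    simp only [coeff_add, mul_add, lp.coeFn_add, Pi.add_apply]
  map_smul' c u := by
    apply Subtype.ext
    funext n
    simp only [coeff_smul, lp.coeFn_smul, Pi.smul_apply, smul_eq_mul, RingHom.id_apply]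
    ring

theorem invSqrtCoord_injective : Function.Injective A.invSqrtCoord := by
  intro u v h
  apply A.coeff_ext
  intro n
  have h1 : (√(A.eigenvalue n))⁻¹ * A.coeff n u = (√(A.eigenvalue n))⁻¹ * A.coeff n v :=
    congrArg (fun s : Seq2 => s n) h
  exact mul_left_cancel₀ (inv_pos.2 (Real.sqrt_pos.2 (A.eigenvalue_pos n))).ne' h1

/-- The energy phase space `E_ε = H¹ × H` for `ε > 0`, with points `ξ = (u, v)`, `v` standing for
`∂_t u`; its norm (below) is `‖ξ‖² = ε‖v‖_H² + ‖v‖_{H⁻¹}² + ‖u‖_{H¹}²`. -/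
def Energy (_ε : ℝ) : Type _ := A.H1 × H

variable (ε : ℝ)

instance : AddCommGroup (A.Energy ε) := inferInstanceAs (AddCommGroup (A.H1 × H))
instance : Module ℝ (A.Energy ε) := inferInstanceAs (Module ℝ (A.H1 × H))

/-- The position component `u` of `ξ = (u, v)`, as a vector of `H`. -/
def pos : A.Energy ε →ₗ[ℝ] H := A.incl ∘ₗ LinearMap.fst ℝ A.H1 H

/-- The velocity component `v` of `ξ = (u, v)`. -/
def vel : A.Energy ε →ₗ[ℝ] H := LinearMap.snd ℝ A.H1 H

/-- Linear map inducing the norm of the energy space. -/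
def energyCoord : A.Energy ε →ₗ[ℝ] WithLp 2 (Seq2 × WithLp 2 (H × Seq2)) :=
  (WithLp.linearEquiv 2 ℝ (Seq2 × WithLp 2 (H × Seq2))).symm.toLinearMap ∘ₗ
    (LinearMap.prod (A.sqrtCoord ∘ₗ LinearMap.fst ℝ A.H1 H)
      ((WithLp.linearEquiv 2 ℝ (H × Seq2)).symm.toLinearMap ∘ₗ
        LinearMap.prod (√ε • LinearMap.snd ℝ A.H1 H)
          (A.invSqrtCoord ∘ₗ LinearMap.snd ℝ A.H1 H)))

theorem energyCoord_injective : Function.Injective (A.energyCoord ε) := by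
  intro ξ η h
  have h1 : A.sqrtCoord ξ.1 = A.sqrtCoord η.1 := congrArg (fun z => z.fst) h
  have h2 : A.invSqrtCoord ξ.2 = A.invSqrtCoord η.2 := congrArg (fun z => z.snd.snd) h
  exact Prod.ext (A.sqrtCoord_injective h1) (A.invSqrtCoord_injective h2)

instance : NormedAddCommGroup (A.Energy ε) :=
  NormedAddCommGroup.induced (A.Energy ε) _ (A.energyCoord ε) (A.energyCoord_injective ε)

instance : NormedSpace ℝ (A.Energy ε) := NormedSpace.induced ℝ (A.Energy ε) _ (A.energyCoord ε)

theorem energy_norm_sq (hε : 0 ≤ ε) (ξ : A.Energy ε) :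
    ‖ξ‖ ^ 2 = ε * ‖A.vel ε ξ‖ ^ 2
      + ∑' n, (A.eigenvalue n)⁻¹ * A.coeff n (A.vel ε ξ) ^ 2
      + ∑' n, A.eigenvalue n * A.coeff n (A.pos ε ξ) ^ 2 := by
  have h : ‖ξ‖ = ‖A.energyCoord ε ξ‖ := rfl
  have h1 : (A.energyCoord ε ξ).fst = A.sqrtCoord ξ.1 := rfl
  have h2 : (A.energyCoord ε ξ).snd.fst = √ε • A.vel ε ξ := rfl
  have h3 : (A.energyCoord ε ξ).snd.snd = A.invSqrtCoord (A.vel ε ξ) := rfl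
  have h4 : ‖A.sqrtCoord ξ.1‖ ^ 2 = ∑' n, A.eigenvalue n * A.coeff n (A.pos ε ξ) ^ 2 :=
    A.H1_norm_sq ξ.1
  have h5 : ‖A.invSqrtCoord (A.vel ε ξ)‖ ^ 2 =
      ∑' n, (A.eigenvalue n)⁻¹ * A.coeff n (A.vel ε ξ) ^ 2 := by
    rw [Seq2_norm_sq]
    refine tsum_congr fun n => ?_
    have h6 : A.invSqrtCoord (A.vel ε ξ) n =
      (√(A.eigenvalue n))⁻¹ * A.coeff n (A.vel ε ξ) := rfl
    rw [h6, mul_pow, inv_pow, Real.sq_sqrt (A.eigenvalue_pos n).le]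
  rw [h, WithLp.prod_norm_sq_eq_of_L2, WithLp.prod_norm_sq_eq_of_L2, h1, h2, h3, h4, h5,
    norm_smul, mul_pow, Real.norm_of_nonneg (Real.sqrt_nonneg _), Real.sq_sqrt hε]
  ring

/-- The subspace `P_N H` spanned by the first `N` eigenvectors. -/
def base (N : ℕ) : Submodule ℝ H := Submodule.span ℝ (A.basis '' {n | n < N})

/-- `S` is the solution semigroup on `E_ε` of `ε ∂_t² u + ∂_t u + A u = F(u)`, for `ε > 0`:
every `t ↦ S t ξ₀ = (u(t), v(t))` belongs to `C([0, ∞), E_ε)`, starts at `ξ₀`, satisfies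
`∂_t u = v`, and satisfies the equation weakly, tested with the elements of `D(A)`. -/
structure IsHyperbolicSemigroup (F : H → H) (S : ℝ → A.Energy ε → A.Energy ε) : Prop where
  init : ∀ ξ₀, S 0 ξ₀ = ξ₀
  cont : ∀ ξ₀, ContinuousOn (fun t => S t ξ₀) (Set.Ici 0)
  velocity : ∀ ξ₀, ∀ t, 0 ≤ t →
    HasDerivWithinAt (fun s => A.pos ε (S s ξ₀)) (A.vel ε (S t ξ₀)) (Set.Ici 0) t
  equation : ∀ ξ₀, ∀ φ : A.op.domain, ∀ t, 0 ≤ t →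
    HasDerivWithinAt (fun s => ε * inner ℝ (A.vel ε (S s ξ₀)) (φ : H))
      (inner ℝ (F (A.pos ε (S t ξ₀))) (φ : H) - inner ℝ (A.vel ε (S t ξ₀)) (φ : H)
        - inner ℝ (A.pos ε (S t ξ₀)) (A.op φ)) (Set.Ici 0) t

/-- `S` is the solution semigroup on `H¹` of the limit parabolic equation `∂_t u + A u = F(u)`
(the case `ε = 0`). A point `u` of `H¹` stands for the point `(u, F(u) - A u)` of the graph
`{(u, v) ∈ H¹ × H⁻¹ : v = F(u) - A u}`. -/
structure IsParabolicSemigroup (F : H → H) (S : ℝ → A.H1 → A.H1) : Prop where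
  init : ∀ u₀, S 0 u₀ = u₀
  cont : ∀ u₀, ContinuousOn (fun t => S t u₀) (Set.Ici 0)
  equation : ∀ u₀, ∀ φ : A.op.domain, ∀ t, 0 ≤ t →
    HasDerivWithinAt (fun s => inner ℝ (A.incl (S s u₀)) (φ : H))
      (inner ℝ (F (A.incl (S t u₀))) (φ : H) - inner ℝ (A.incl (S t u₀)) (A.op φ))
      (Set.Ici 0) t

end PosOp

/-! ### Normally hyperbolic inertial manifolds of a semigroup on a normed space -/

variable {X : Type*} [NormedAddCommGroup X] [NormedSpace ℝ X]

/-- Near its point `ξ` the set `M` is an `N`-dimensional embedded `C¹` submanifold of `X` with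
tangent space `T` at `ξ`: some relatively open part of `M` around `ξ` is the homeomorphic image of
an open set of `ℝ^N` under a `C¹` immersion `φ` with `φ 0 = ξ`, and `T` is the range of the
derivative of `φ` at `0`. -/
def HasTangentSpaceAt (N : ℕ) (M : Set X) (ξ : X) (T : Submodule ℝ X) : Prop :=
  ∃ (φ : EuclideanSpace ℝ (Fin N) → X) (V : Set (EuclideanSpace ℝ (Fin N))) (U : Set X),
    IsOpen V ∧ 0 ∈ V ∧ φ 0 = ξ ∧ IsOpen U ∧ φ '' V = M ∩ U ∧
    ContDiffOn ℝ 1 φ V ∧ (∀ x ∈ V, Function.Injective (fderiv ℝ φ x)) ∧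
    Topology.IsEmbedding (V.domRestrict φ) ∧
    T = LinearMap.range (fderiv ℝ φ 0).toLinearMap

/-- `M ⊆ X` is an inertial manifold with base `B` (here a finite-dimensional space) of the
semigroup `S`. The submanifold is required to be the image of `B` under a locally Lipschitz closed
topological embedding, which covers all bi-Lipschitz images of `B` and Lipschitz graphs over it. -/
structure IsInertialManifold (B : Type*) [NormedAddCommGroup B] (S : ℝ → X → X) (M : Set X) :
    Prop where
  manifold : ∃ Φ : B → X, LocallyLipschitz Φ ∧ Topology.IsClosedEmbedding Φ ∧ Set.range Φ = M
  invariant : ∀ t, 0 ≤ t → S t '' M = M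
  tracking : ∃ C > 0, ∃ θ > 0, ∀ ξ₀ : X, ∃ ξ₁ ∈ M, ∀ t, 0 ≤ t →
    ‖S t ξ₀ - S t ξ₁‖ ≤ C * ‖ξ₀‖ * Real.exp (-θ * t)

/-- `M` is an `N`-dimensional stable and absolutely normally hyperbolic `C¹` submanifold for the
semigroup `S`. Here `T ξ` and `V ξ` are the tangent and the normal fibre at `ξ`, and
`fderiv ℝ (S t) ξ` is `D_ξ S(t)`. Only `C¹` smoothness of `M`, differentiability of `S t` at the points of `M`, and no
continuity of `ξ ↦ V ξ` are required, so that the notion is as wide as possible. -/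
structure IsNormallyHyperbolic (N : ℕ) (S : ℝ → X → X) (M : Set X) : Prop where
  invariant : ∀ t, 0 ≤ t → Set.MapsTo (S t) M M
  differentiable : ∀ t, 0 ≤ t → ∀ ξ ∈ M, DifferentiableAt ℝ (S t) ξ
  splitting : ∃ T V : X → Submodule ℝ X,
    (∀ ξ ∈ M, HasTangentSpaceAt N M ξ (T ξ)) ∧
    (∀ t, 0 ≤ t → ∀ ξ ∈ M, ∀ η ∈ V ξ, fderiv ℝ (S t) ξ η ∈ V (S t ξ)) ∧
    (∃ C : ℝ, ∀ ξ ∈ M, IsCompl (T ξ) (V ξ) ∧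
      ∃ P Q : X →L[ℝ] X, (∀ η, P η ∈ T ξ) ∧ (∀ η, Q η ∈ V ξ) ∧ (∀ η, P η + Q η = η) ∧
        ‖P‖ + ‖Q‖ ≤ C) ∧
    (∃ C θ κ : ℝ, 0 < C ∧ 0 < θ ∧ 0 < κ ∧ κ < θ ∧ ∀ ξ ∈ M, ∀ t, 0 ≤ t →
      (∀ η ∈ V ξ, ‖fderiv ℝ (S t) ξ η‖ ≤ C * Real.exp (-(θ + κ) * t) * ‖η‖) ∧
      (∀ η ∈ T ξ, C⁻¹ * Real.exp (-(θ - κ) * t) * ‖η‖ ≤ ‖fderiv ℝ (S t) ξ η‖))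

/-- `M` is an `N`-dimensional normally hyperbolic inertial manifold of `S`, with base `P_N H`. -/
def IsNHIM (A : PosOp H) (N : ℕ) (S : ℝ → X → X) (M : Set X) : Prop :=
  IsInertialManifold (A.base N) S M ∧ IsNormallyHyperbolic N S M

/-- The equation `ε ∂_t² u + ∂_t u + A u = F(u)` possesses a normally hyperbolic inertial manifold
of dimension `N`. The phase space is `E_ε = H¹ × H` for `ε ≠ 0`, and `H¹` for `ε = 0`. -/
def PossessesNHIM (A : PosOp H) (ε : ℝ) (F : H → H) (N : ℕ) : Prop :=
  (ε ≠ 0 ∧ ∃ S : ℝ → A.Energy ε → A.Energy ε, A.IsHyperbolicSemigroup ε F S ∧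
    ∃ M : Set (A.Energy ε), IsNHIM A N S M) ∨
  (ε = 0 ∧ ∃ S : ℝ → A.H1 → A.H1, A.IsParabolicSemigroup F S ∧
    ∃ M : Set A.H1, IsNHIM A N S M)

end

end RelaxedIM

/-! The dimension of a normally hyperbolic inertial manifold is forced to be even by one equilibrium
of a suitable equation and odd by another.

A fixed point of the semigroup lies on every inertial manifold: the trajectory tracking it stays on
the manifold, which is closed, and converges to the point. At the fixed point the normal fibre `V`
is closed, has codimension `N`, and is invariant under the derivative of `S t`, which therefore acts
on the `N`-dimensional quotient by `V`. If the derivative acts by nonreal scalars on complex lines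
whose real parts span a dense subspace, no real eigenfunctional survives on the quotient, so `N` is
even (`even_finrank_quotient`). One additional real eigenvector outside `V` makes `N` odd
(`odd_finrank_quotient`).

The map `F` is built with two equilibria and is affine near each (`exists_nonlinearity`). Near the
first, `F` couples neighbouring eigenvectors by a rotation of strength `a < L`, which makes the two
eigenvalues of `A - K` a nonreal pair as soon as the gap is below `2 * a`. Where `4 * ε * λ ≥ 1` no
coupling is needed: subtracting `a` already makes the decay rates of the damped wave equation
nonreal. Near the second equilibrium, `0`, the first eigenvector is left alone with weight `a` above
its eigenvalue and the pairing is shifted by one index; this gives a growing real direction.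

For `ε > 0` the first mode at `0` has two real rates, one negative and one above `1 / (2 * ε)`.
Infinitely many other modes decay at exactly `1 / (2 * ε)`, which bounds the rate of the normal
fibre (`hyperbolic_decay_rate_le`) and so places the fast direction inside `V`. Exactly one real
direction is left outside.

No linearization theory is used: since `F` is affine near the equilibria, small multiples of modes
evolve explicitly, and uniqueness identifies them with the given semigroup. -/

namespace RelaxedIM

noncomputable section

open Filter Topology

/-! ### Parity of the codimension of an invariant subspace, and fibres at fixed points. -/

section

/-- A real linear functional which is an eigenvector of the transpose of an endomorphism exists in
odd dimension. -/
theorem exists_eigenfunctional_of_odd_finrank {W : Type*} [AddCommGroup W] [Module ℝ W]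
    [FiniteDimensional ℝ W] (hodd : Odd (Module.finrank ℝ W)) (T : W →ₗ[ℝ] W) :
    ∃ (ℓ : W →ₗ[ℝ] ℝ) (x : ℝ), ℓ ≠ 0 ∧ ∀ w, ℓ (T w) = x * ℓ w := by
  set D : Module.End ℝ (Module.Dual ℝ W) := Module.Dual.transpose (R := ℝ) T with hD
  have hn : D.charpoly.natDegree = Module.finrank ℝ W := by
    rw [LinearMap.charpoly_natDegree, Subspace.dual_finrank_eq]
  have hm : D.charpoly.Monic := LinearMap.charpoly_monic D
  -- A monic real polynomial of odd degree takes all real values.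
  obtain ⟨x, hx⟩ : ∃ x, D.charpoly.IsRoot x := by
    have h1 : Tendsto (fun x => D.charpoly.eval x) atTop atTop := by
      refine Polynomial.tendsto_atTop_of_leadingCoeff_nonneg _ ?_ ?_
      · rw [← Polynomial.natDegree_pos_iff_degree_pos, hn]
        exact hodd.pos
      · rw [hm.leadingCoeff]; exact zero_le_one
    have h2 : Tendsto (fun x => D.charpoly.eval x) atBot atBot := by
      have h3 := D.charpoly.isEquivalent_atBot_lead
      refine h3.symm.tendsto_atBot ?_
      rw [hm.leadingCoeff, hn]
      simp only [one_mul]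
      exact hodd.strictMono_pow.monotone.tendsto_atBot_atBot fun b => by
        refine ⟨-(|b| + 1), ?_⟩
        rw [Odd.neg_pow hodd]
        have : |b| + 1 ≤ (|b| + 1) ^ Module.finrank ℝ W :=
          le_self_pow₀ (by linarith [abs_nonneg b]) hodd.pos.ne'
        linarith [neg_abs_le b]
    exact (Polynomial.continuous _).surjective h1 h2 0
  obtain ⟨ℓ, hℓ⟩ := ((Module.End.hasEigenvalue_iff_isRoot_charpoly D x).2 hx).exists_hasEigenvector
  refine ⟨ℓ, x, hℓ.2, fun w => ?_⟩
  have := congrArg (fun f : Module.Dual ℝ W => f w) hℓ.apply_eq_smul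
  simpa [hD, Module.Dual.transpose] using this

variable {X : Type*} [NormedAddCommGroup X] [NormedSpace ℝ X]

/-- If a bounded operator acts as a nonreal scalar on a family of complex lines which, together
with a closed invariant subspace `V` of finite codimension, generate a dense subspace, then the
codimension of `V` is even. -/
theorem even_finrank_quotient {ι : Type*} (E : X →L[ℝ] X) (V : Submodule ℝ X)
    [FiniteDimensional ℝ (X ⧸ V)] (hV : IsClosed (V : Set X)) (hE : ∀ η ∈ V, E η ∈ V)
    (ψ : ι → ℂ →ₗ[ℝ] X) (a : ι → ℂ) (ha : ∀ k, (a k).im ≠ 0)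
    (hψ : ∀ k c, E (ψ k c) = ψ k (a k * c))
    (hd : ∀ ℓ : X →L[ℝ] ℝ, (∀ η ∈ V, ℓ η = 0) → (∀ k c, ℓ (ψ k c) = 0) → ℓ = 0) :
    Even (Module.finrank ℝ (X ⧸ V)) := by
  by_contra hodd
  rw [Nat.not_even_iff_odd] at hodd
  have hT : V ≤ V.comap E.toLinearMap := hE
  obtain ⟨ℓ, x, hℓ0, hℓ⟩ := exists_eigenfunctional_of_odd_finrank hodd (V.mapQ V E.toLinearMap hT)
  have : IsClosed (V : Set X) := hV
  have hmk : Continuous (V.mkQ : X → X ⧸ V) := continuous_quot_mk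
  let m : X →L[ℝ] ℝ :=
    ⟨ℓ ∘ₗ V.mkQ, (LinearMap.continuous_of_finiteDimensional ℓ).comp hmk⟩
  have hmE : ∀ η, m (E η) = x * m η := fun η => hℓ (V.mkQ η)
  have hm0 : m = 0 := by
    refine hd m (fun η hη => ?_) (fun k c => ?_)
    · have : V.mkQ η = 0 := (Submodule.Quotient.mk_eq_zero V).2 hη
      change ℓ (V.mkQ η) = 0
      rw [this, map_zero]
    · have hne : a k - (x : ℂ) ≠ 0 := by
        intro h
        apply ha k
        have := congrArg Complex.im h
        simpa using this
      -- On the line `ψ k` the functional satisfies `m (ψ k (a k * c)) = x * m (ψ k c)`. It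
      -- therefore kills the image of multiplication by `a k - x`, which is the whole line because
      -- `a k` is nonreal.
      have h1 : m (ψ k ((a k - x) * ((a k - x)⁻¹ * c))) = 0 := by
        rw [sub_mul, map_sub, map_sub, ← hψ, hmE]
        have : (x : ℂ) * ((a k - x)⁻¹ * c) = x • ((a k - x)⁻¹ * c) := by simp
        rw [this, map_smul, map_smul, smul_eq_mul, sub_self]
      rwa [mul_inv_cancel_left₀ hne] at h1
  apply hℓ0
  ext w
  exact congrArg (fun f : X →L[ℝ] ℝ => f w) hm0

theorem HasTangentSpaceAt.finrank_eq {N : ℕ} {M : Set X} {ξ : X} {T : Submodule ℝ X}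
    (h : HasTangentSpaceAt N M ξ T) : Module.finrank ℝ T = N ∧ FiniteDimensional ℝ T := by
  obtain ⟨φ, V, U, -, h0, -, -, -, -, hinj, -, rfl⟩ := h
  refine ⟨?_, inferInstance⟩
  rw [LinearMap.finrank_range_of_inj (hinj 0 h0)]
  simp

/-- A fixed point of the semigroup lies on every inertial manifold. -/
theorem IsInertialManifold.mem_of_fixed {Y : Type*} [NormedAddCommGroup Y] {B : Type*}
    [NormedAddCommGroup B] {S : ℝ → Y → Y} {M : Set Y} (h : IsInertialManifold B S M) {ξ : Y}
    (hξ : ∀ t, 0 ≤ t → S t ξ = ξ) : ξ ∈ M := by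
  obtain ⟨Φ, -, hΦ, hr⟩ := h.manifold
  have hM : IsClosed M := hr ▸ hΦ.isClosed_range
  obtain ⟨C, -, θ, hθ, ht⟩ := h.tracking
  obtain ⟨ξ₁, h1, h2⟩ := ht ξ
  -- `S t ξ₁` stays in the closed set `M` and tends to `ξ`, because the tracked trajectory does not
  -- move.
  refine hM.mem_of_tendsto (f := fun t => S t ξ₁) (b := atTop) ?_ ?_
  · rw [tendsto_iff_norm_sub_tendsto_zero]
    have hlim : Tendsto (fun t => C * ‖ξ‖ * Real.exp (-θ * t)) atTop (𝓝 0) := by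
      rw [← mul_zero (C * ‖ξ‖)]
      refine Tendsto.const_mul _ (Real.tendsto_exp_atBot.comp ?_)
      exact tendsto_id.const_mul_atTop_of_neg (by linarith)
    refine squeeze_zero' (Eventually.of_forall fun _ => norm_nonneg _) ?_ hlim
    filter_upwards [eventually_ge_atTop 0] with t ht0
    rw [norm_sub_rev]
    simpa [hξ t ht0] using h2 t ht0
  · filter_upwards [eventually_ge_atTop 0] with t ht0
    rw [← h.invariant t ht0]
    exact ⟨ξ₁, h1, rfl⟩

theorem tendsto_exp_mul_atTop_zero {r : ℝ} (hr : r < 0) (C : ℝ) :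
    Tendsto (fun t : ℝ => C * Real.exp (r * t)) atTop (𝓝 0) := by
  rw [← mul_zero C]
  exact Tendsto.const_mul _ (Real.tendsto_exp_atBot.comp (tendsto_id.const_mul_atTop_of_neg hr))

/-- The normal fibre of a normally hyperbolic manifold at a fixed point of the semigroup. -/
theorem IsNormallyHyperbolic.normalFibre {N : ℕ} {S : ℝ → X → X} {M : Set X}
    (h : IsNormallyHyperbolic N S M) {ξ : X} (hM : ξ ∈ M) (hξ : ∀ t, 0 ≤ t → S t ξ = ξ) :
    ∃ (V : Submodule ℝ X) (C ρ σ : ℝ), IsClosed (V : Set X) ∧ FiniteDimensional ℝ (X ⧸ V) ∧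
      Module.finrank ℝ (X ⧸ V) = N ∧ 0 < ρ ∧ σ < ρ ∧
      (∀ t, 0 ≤ t → ∀ η ∈ V, fderiv ℝ (S t) ξ η ∈ V) ∧
      (∀ t, 0 ≤ t → ∀ η ∈ V, ‖fderiv ℝ (S t) ξ η‖ ≤ C * Real.exp (-ρ * t) * ‖η‖) ∧
      (∀ η r, σ < r → (∃ B, ∀ t, 0 ≤ t → ‖fderiv ℝ (S t) ξ η‖ ≤ B * Real.exp (-r * t)) →
        η ∈ V) := by
  obtain ⟨T, V, hT, hV, ⟨_, hsplit⟩, C, θ, κ, hC, hθ, hκ, hκθ, hrate⟩ := h.splitting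
  obtain ⟨hcompl, P, Q, hP, hQ, hPQ, -⟩ := hsplit ξ hM
  obtain ⟨hfr, hfd⟩ := (hT ξ hM).finrank_eq
  have hfix : ∀ t, 0 ≤ t → ∀ η ∈ V ξ, fderiv ℝ (S t) ξ η ∈ V ξ := by
    intro t ht η hη
    have := hV t ht ξ hM η hη
    rwa [hξ t ht] at this
  -- The fibre is the kernel of the bounded projector onto the tangent space.
  have hclosed : IsClosed (V ξ : Set X) := by
    have : (V ξ : Set X) = {η | P η = 0} := by
      ext η
      constructor
      · intro hη
        have h1 : P η ∈ V ξ := by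
          have : P η = η - Q η := eq_sub_of_add_eq (hPQ η)
          rw [this]
          exact (V ξ).sub_mem hη (hQ η)
        exact (Submodule.disjoint_def.1 hcompl.disjoint) _ (hP η) h1
      · intro hη
        have h1 := hPQ η
        rw [Set.mem_ofPred_eq.mp hη, zero_add] at h1
        rw [← h1]
        exact hQ η
    rw [this]
    exact isClosed_eq P.continuous continuous_const
  let e := (V ξ).quotientEquivOfIsCompl (T ξ) hcompl.symm
  have := hfd
  refine ⟨V ξ, C, θ + κ, θ - κ, hclosed, e.symm.finiteDimensional, ?_, by linarith, by linarith,
    hfix, fun t ht => (hrate ξ hM t ht).1, ?_⟩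
  · rw [e.finrank_eq, hfr]
  · rintro η r hr ⟨B, hB⟩
    -- The tangential part of `η` cannot decay faster than `exp (-(θ - κ) * t)`, while both `η` and
    -- its normal part do. Dividing by this factor leaves two vanishing exponentials.
    have hkey : ∀ t, 0 ≤ t →
        ‖P η‖ ≤ C * B * Real.exp (-(r - (θ - κ)) * t) + C * (C * ‖Q η‖) * Real.exp (-(2 * κ) * t) := by
      intro t ht
      have h1 := (hrate ξ hM t ht).2 _ (hP η)
      have h2 := (hrate ξ hM t ht).1 _ (hQ η)
      have h3 := hB t ht
      have h4 : fderiv ℝ (S t) ξ (P η) = fderiv ℝ (S t) ξ η - fderiv ℝ (S t) ξ (Q η) := by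
        rw [← map_sub, ← eq_sub_of_add_eq (hPQ η)]
      have h5 : ‖fderiv ℝ (S t) ξ (P η)‖ ≤
          B * Real.exp (-r * t) + C * Real.exp (-(θ + κ) * t) * ‖Q η‖ := by
        rw [h4]; exact (norm_sub_le _ _).trans (add_le_add h3 h2)
      have h6 := h1.trans h5
      have h7 := mul_le_mul_of_nonneg_left h6
        (mul_nonneg hC.le (Real.exp_nonneg ((θ - κ) * t)))
      have e1 : C * Real.exp ((θ - κ) * t) * (C⁻¹ * Real.exp (-(θ - κ) * t) * ‖P η‖) = ‖P η‖ := by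
        have : Real.exp ((θ - κ) * t) * Real.exp (-(θ - κ) * t) = 1 := by
          rw [← Real.exp_add]; ring_nf; exact Real.exp_zero
        calc _ = C * C⁻¹ * (Real.exp ((θ - κ) * t) * Real.exp (-(θ - κ) * t)) * ‖P η‖ := by ring
          _ = _ := by rw [this, mul_inv_cancel₀ hC.ne']; ring
      have e2 : Real.exp (-(r - (θ - κ)) * t) = Real.exp ((θ - κ) * t) * Real.exp (-r * t) := by
        rw [← Real.exp_add]; ring_nf
      have e3 : Real.exp (-(2 * κ) * t) =
          Real.exp ((θ - κ) * t) * Real.exp (-(θ + κ) * t) := by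
        rw [← Real.exp_add]; ring_nf
      rw [e1] at h7
      rw [e2, e3]
      linarith
    have hlim := (tendsto_exp_mul_atTop_zero (r := -(r - (θ - κ))) (by linarith) (C * B)).add
      (tendsto_exp_mul_atTop_zero (r := -(2 * κ)) (by linarith) (C * (C * ‖Q η‖)))
    rw [add_zero] at hlim
    have h0 : ‖P η‖ ≤ 0 := ge_of_tendsto hlim (by
      filter_upwards [eventually_ge_atTop 0] with t ht using hkey t ht)
    have hP0 : P η = 0 := norm_le_zero_iff.1 h0
    have h1 := hPQ η
    rw [hP0, zero_add] at h1
    rw [← h1]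
    exact hQ η

end

/-! ### Fourier coordinates, weighted permutations and cutoff functions. -/

section

variable {H : Type*} [NormedAddCommGroup H] [InnerProductSpace ℝ H] [CompleteSpace H]

namespace PosOp

variable (A : PosOp H)

theorem coeff_sub (n : ℕ) (u v : H) : A.coeff n (u - v) = A.coeff n u - A.coeff n v :=
  inner_sub_right _ _ _

@[simp] theorem coeff_zero (n : ℕ) : A.coeff n (0 : H) = 0 := inner_zero_right _

theorem coeff_basis (n m : ℕ) : A.coeff n (A.basis m) = if n = m then 1 else 0 :=
  orthonormal_iff_ite.1 A.basis.orthonormal n m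

theorem coeff_eq_repr (n : ℕ) (u : H) : A.coeff n u = A.basis.repr u n :=
  (A.basis.repr_apply_apply u n).symm

theorem norm_sq_eq_tsum (u : H) : ‖u‖ ^ 2 = ∑' n, A.coeff n u ^ 2 := by
  rw [← A.basis.repr.norm_map u, Seq2_norm_sq]
  exact tsum_congr fun n => by rw [A.coeff_eq_repr]

theorem _root_.RelaxedIM.Seq2.summable_sq (x : Seq2) : Summable fun n => x n ^ 2 := by
  simpa using (memℓp_gen_iff (p := 2) (by norm_num)).1 (lp.memℓp x)

theorem summable_coeff_sq (u : H) : Summable fun n => A.coeff n u ^ 2 := by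
  simpa only [A.coeff_eq_repr] using Seq2.summable_sq (A.basis.repr u)

theorem sum_coeff_sq_le (s : Finset ℕ) (u : H) : ∑ n ∈ s, A.coeff n u ^ 2 ≤ ‖u‖ ^ 2 := by
  rw [A.norm_sq_eq_tsum]
  exact (A.summable_coeff_sq u).sum_le_tsum s fun n _ => sq_nonneg _

theorem abs_coeff_le (n : ℕ) (u : H) : |A.coeff n u| ≤ ‖u‖ := by
  refine abs_le_of_sq_le_sq ?_ (norm_nonneg _)
  simpa using A.sum_coeff_sq_le {n} u

/-- The `n`-th Fourier coefficient as a continuous functional on `H`. -/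
def coeffL (n : ℕ) : H →L[ℝ] ℝ := innerSL ℝ (A.basis n)

@[simp] theorem coeffL_apply (n : ℕ) (u : H) : A.coeffL n u = A.coeff n u := rfl

/-- An injective relabelling of coordinates does not increase the `ℓ²` norm, so a weighted
permutation is bounded by its largest weight. -/
theorem norm_le_of_abs_coeff_le {σ : ℕ → ℕ} (hσ : Function.Injective σ) {a : ℝ} (ha : 0 ≤ a)
    {x y : H} (h : ∀ n, |A.coeff n y| ≤ a * |A.coeff (σ n) x|) : ‖y‖ ≤ a * ‖x‖ := by
  refine abs_le_of_sq_le_sq' ?_ (by positivity) |>.2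
  rw [mul_pow, A.norm_sq_eq_tsum y, A.norm_sq_eq_tsum x, ← tsum_mul_left]
  have hs := (A.summable_coeff_sq x).mul_left (a ^ 2)
  refine le_trans ((A.summable_coeff_sq y).tsum_le_tsum (fun n => ?_) (hs.comp_injective hσ))
    (tsum_comp_le_tsum_of_inj hs (fun n => by positivity) hσ)
  rw [Function.comp_apply, ← mul_pow, ← abs_of_nonneg ha, ← sq_abs (A.coeff n y), ← sq_abs (_ * _), abs_mul, abs_abs]
  exact pow_le_pow_left₀ (abs_nonneg _) (by simpa [abs_of_nonneg ha] using h n) 2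

/-- The operator `(K u)_n = s_n u_{σ n}` in Fourier coordinates. -/
theorem exists_weightedPerm {σ : ℕ → ℕ} (hσ : Function.Injective σ) {s : ℕ → ℝ} {a : ℝ}
    (hs : ∀ n, |s n| ≤ a) :
    ∃ K : H →L[ℝ] H, ∀ n u, A.coeff n (K u) = s n * A.coeff (σ n) u := by
  have ha : 0 ≤ a := (abs_nonneg _).trans (hs 0)
  have hmem : ∀ u, Memℓp (fun n => s n * A.coeff (σ n) u) 2 := by
    intro u
    refine (memℓp_gen_iff (by norm_num)).2 ?_
    have h1 := ((A.summable_coeff_sq u).mul_left (a ^ 2)).comp_injective hσ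
    refine Summable.of_nonneg_of_le (fun n => by positivity) (fun n => ?_) h1
    simp only [ENNReal.toReal_ofNat, Real.rpow_ofNat, Real.norm_eq_abs, sq_abs,
      Function.comp_apply, mul_pow]
    refine mul_le_mul_of_nonneg_right ?_ (sq_nonneg _)
    rw [← sq_abs]
    exact pow_le_pow_left₀ (abs_nonneg _) (hs n) 2
  let K0 : H →ₗ[ℝ] H :=
    { toFun := fun u => A.basis.repr.symm ⟨_, hmem u⟩
      map_add' := fun u v => by
        rw [← map_add]
        congr 1
        apply Subtype.ext
        funext n
        simp only [coeff_add, mul_add, lp.coeFn_add, Pi.add_apply]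
      map_smul' := fun c u => by
        rw [RingHom.id_apply, ← map_smul]
        congr 1
        apply Subtype.ext
        funext n
        simp only [coeff_smul, lp.coeFn_smul, Pi.smul_apply, smul_eq_mul]
        ring }
  have hK0 : ∀ n u, A.coeff n (K0 u) = s n * A.coeff (σ n) u := by
    intro n u
    rw [A.coeff_eq_repr]
    change A.basis.repr (A.basis.repr.symm _) n = _
    rw [LinearIsometryEquiv.apply_symm_apply]
  refine ⟨K0.mkContinuous a fun u => A.norm_le_of_abs_coeff_le hσ ha fun n => ?_, hK0⟩
  rw [hK0, abs_mul]
  exact mul_le_mul_of_nonneg_right (hs n) (abs_nonneg _)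

end PosOp

/-- The derivative of the standard smooth transition is bounded. -/
theorem exists_bound_deriv_smoothTransition :
    ∃ B > 0, ∀ x, |deriv Real.smoothTransition x| ≤ B := by
  have hc : Continuous (deriv Real.smoothTransition) :=
    (Real.smoothTransition.contDiff (n := 1)).continuous_deriv le_rfl
  obtain ⟨B, hB⟩ := isCompact_Icc.exists_bound_of_continuousOn (s := Set.Icc (0 : ℝ) 1)
    hc.continuousOn
  refine ⟨max B 1, by positivity, fun x => ?_⟩
  by_cases hx : x ∈ Set.Icc (0 : ℝ) 1
  · exact (hB x hx).trans (le_max_left _ _)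
  · have h0 : deriv Real.smoothTransition x = 0 := by
      rcases lt_or_ge x 0 with h | h
      · have : Real.smoothTransition =ᶠ[𝓝 x] fun _ => 0 := by
          filter_upwards [Iio_mem_nhds h] with y hy
            using Real.smoothTransition.zero_of_nonpos (le_of_lt hy)
        rw [this.deriv_eq, deriv_const]
      · have h1 : 1 < x := by
          by_contra h2
          exact hx ⟨h, not_lt.1 h2⟩
        have : Real.smoothTransition =ᶠ[𝓝 x] fun _ => 1 := by
          filter_upwards [Ioi_mem_nhds h1] with y hy
            using Real.smoothTransition.one_of_one_le (le_of_lt hy)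
        rw [this.deriv_eq, deriv_const]
    rw [h0, abs_zero]
    positivity

/-- A smooth cutoff function whose gradient at `v` is at most `δ / ‖v‖`. -/
theorem exists_slow_cutoff (H : Type*) [NormedAddCommGroup H] [InnerProductSpace ℝ H] {δ : ℝ}
    (hδ : 0 < δ) : ∃ (χ : H → ℝ) (r R : ℝ), 0 < r ∧ 0 < R ∧
      ContDiff ℝ ((⊤ : ℕ∞) : WithTop ℕ∞) χ ∧ (∀ v, 0 ≤ χ v ∧ χ v ≤ 1) ∧
      (∀ v, ‖v‖ ≤ r → χ v = 1) ∧ (∀ v, R ≤ ‖v‖ → χ v = 0) ∧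
      (∀ v, ‖fderiv ℝ χ v‖ * ‖v‖ ≤ δ) := by
  obtain ⟨B, hB0, hB⟩ := exists_bound_deriv_smoothTransition
  set d : ℝ := δ / (2 * B) with hd
  have hd0 : 0 < d := by positivity
  have hpos : ∀ v : H, (1 : ℝ) + ‖v‖ ^ 2 ≠ 0 := fun v => by positivity
  -- The logarithm makes the cutoff slow: the gradient of `log (1 + ‖v‖ ^ 2)` times `‖v‖` is at most
  -- `2`, uniformly in `v`, and `d` scales the product down to `δ`.
  set χ : H → ℝ := fun v => 1 - Real.smoothTransition (d * Real.log (1 + ‖v‖ ^ 2) - 1) with hχ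
  -- At these radii the argument of the transition function is at most `0`, respectively at least
  -- `1`.
  refine ⟨χ, √(Real.exp d⁻¹ - 1), √(Real.exp (2 / d)), ?_, ?_, ?_, ?_, ?_, ?_, ?_⟩
  · rw [Real.sqrt_pos, sub_pos, Real.one_lt_exp_iff]
    positivity
  · rw [Real.sqrt_pos]
    positivity
  · refine contDiff_const.sub (Real.smoothTransition.contDiff.comp ?_)
    refine ContDiff.sub (contDiff_const.mul (ContDiff.log ?_ hpos)) contDiff_const
    exact contDiff_const.add (contDiff_id.norm_sq ℝ)
  · intro v
    have h1 := Real.smoothTransition.le_one (d * Real.log (1 + ‖v‖ ^ 2) - 1)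
    have h2 := Real.smoothTransition.nonneg (d * Real.log (1 + ‖v‖ ^ 2) - 1)
    simp only [hχ]
    constructor <;> linarith
  · intro v hv
    have h1 : ‖v‖ ^ 2 ≤ Real.exp d⁻¹ - 1 := by
      rw [← Real.sq_sqrt (x := Real.exp d⁻¹ - 1)]
      · exact pow_le_pow_left₀ (norm_nonneg _) hv 2
      · rw [sub_nonneg, Real.one_le_exp_iff]
        positivity
    have h2 : Real.log (1 + ‖v‖ ^ 2) ≤ d⁻¹ := by
      rw [Real.log_le_iff_le_exp (by positivity)]
      linarith
    have h3 : d * Real.log (1 + ‖v‖ ^ 2) ≤ 1 := by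
      have := mul_le_mul_of_nonneg_left h2 hd0.le
      rwa [mul_inv_cancel₀ hd0.ne'] at this
    simp only [hχ]
    rw [Real.smoothTransition.zero_of_nonpos (by linarith), sub_zero]
  · intro v hv
    have h1 : Real.exp (2 / d) ≤ ‖v‖ ^ 2 := by
      rw [← Real.sq_sqrt (Real.exp_nonneg (2 / d))]
      exact pow_le_pow_left₀ (Real.sqrt_nonneg _) hv 2
    have h2 : 2 / d ≤ Real.log (1 + ‖v‖ ^ 2) := by
      rw [Real.le_log_iff_exp_le (by positivity)]
      linarith
    have h3 : 2 ≤ d * Real.log (1 + ‖v‖ ^ 2) := by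
      have := mul_le_mul_of_nonneg_left h2 hd0.le
      rwa [mul_div_cancel₀ _ hd0.ne'] at this
    simp only [hχ]
    rw [Real.smoothTransition.one_of_one_le (by linarith), sub_self]
  · intro v
    set x := d * Real.log (1 + ‖v‖ ^ 2) - 1 with hx
    have h1 : HasFDerivAt (fun v : H => ‖v‖ ^ 2) (2 • (innerSL ℝ v)) v :=
      (hasStrictFDerivAt_norm_sq v).hasFDerivAt
    have h2 := ((h1.const_add 1).log (hpos v)).const_mul d |>.sub_const 1
    have h3 : HasDerivAt Real.smoothTransition (deriv Real.smoothTransition x) x :=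
      ((Real.smoothTransition.contDiff (n := 1)).differentiable one_ne_zero x).hasDerivAt
    have h4 := (h3.comp_hasFDerivAt v h2).const_sub 1
    have h5 : fderiv ℝ χ v = _ := h4.fderiv
    rw [h5, norm_neg, norm_smul, norm_smul, norm_smul]
    have h6 : ‖(2 : ℕ) • innerSL ℝ v‖ ≤ 2 * ‖v‖ := by
      refine (norm_nsmul_le).trans ?_
      rw [innerSL_apply_norm]; simp
    have h7 : ‖(1 + ‖v‖ ^ 2)⁻¹‖ = (1 + ‖v‖ ^ 2)⁻¹ := Real.norm_of_nonneg (by positivity)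
    have h8 : ‖v‖ ^ 2 / (1 + ‖v‖ ^ 2) ≤ 1 := by
      rw [div_le_one (by positivity)]
      linarith
    rw [h7, Real.norm_of_nonneg hd0.le, Real.norm_eq_abs]
    calc |deriv Real.smoothTransition x| * (d * ((1 + ‖v‖ ^ 2)⁻¹ * ‖(2 : ℕ) • innerSL ℝ v‖)) * ‖v‖
        ≤ B * (d * ((1 + ‖v‖ ^ 2)⁻¹ * (2 * ‖v‖))) * ‖v‖ := by
          gcongr
          exact hB x
      _ = 2 * B * d * (‖v‖ ^ 2 / (1 + ‖v‖ ^ 2)) := by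
          rw [div_eq_mul_inv]; ring
      _ ≤ 2 * B * d * 1 := by gcongr
      _ = δ := by rw [hd]; field_simp

/-- A smooth function on the line with slope in `[0, a]`, equal to `a x` near `0` and to the
constant `l R` on a neighbourhood of `R` of prescribed size. -/
theorem exists_smooth_plateau {l a R₀ : ℝ} (hl : 0 < l) (hla : l < a) :
    ∃ (g : ℝ → ℝ) (R : ℝ), R₀ + 2 ≤ R ∧ ContDiff ℝ ((⊤ : ℕ∞) : WithTop ℕ∞) g ∧
      (∀ x, 0 ≤ deriv g x ∧ deriv g x ≤ a) ∧ (∀ x, x ≤ 1 → g x = a * x) ∧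
      (∀ x, R - R₀ - 1 ≤ x → g x = l * R ∧ deriv g x = 0) := by
  have ha : 0 < a := hl.trans hla
  -- The slope is `a` up to `T` and `0` from `T + 1` on; `R` is defined so that the final value is
  -- `l * R`. As `a > l`, a large `T` pushes `R` beyond the start of the plateau by the margin `R₀ +
  -- 1`.
  set T : ℝ := max 1 ((R₀ + 2) / (a / l - 1)) with hT
  have hal : 0 < a / l - 1 := by rw [sub_pos, one_lt_div hl]; exact hla
  have hT1 : 1 ≤ T := le_max_left _ _
  have hT2 : R₀ + 2 ≤ T * (a / l - 1) := by
    rw [← div_le_iff₀ hal]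
    exact le_max_right _ _
  set h : ℝ → ℝ := fun x => a * Real.smoothTransition (T + 1 - x) with hh
  have hsm : ∀ n : ℕ∞, ContDiff ℝ n h := fun n =>
    contDiff_const.mul (Real.smoothTransition.contDiff.comp (contDiff_const.sub contDiff_id))
  have hcont : Continuous h := (hsm 0).continuous
  have hint : ∀ x y, IntervalIntegrable h MeasureTheory.volume x y := fun x y =>
    hcont.intervalIntegrable x y
  set g : ℝ → ℝ := fun x => ∫ y in (0 : ℝ)..x, h y with hg
  have hder : ∀ x, HasDerivAt g (h x) x := fun x =>
    intervalIntegral.integral_hasDerivAt_right (hint 0 x)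
      (hcont.stronglyMeasurableAtFilter _ _) hcont.continuousAt
  have hderiv : deriv g = h := funext fun x => (hder x).deriv
  have hh1 : ∀ x, x ≤ T → h x = a := fun x hx => by
    simp only [hh]
    rw [Real.smoothTransition.one_of_one_le (by linarith), mul_one]
  have hh0 : ∀ x, T + 1 ≤ x → h x = 0 := fun x hx => by
    simp only [hh]
    rw [Real.smoothTransition.zero_of_nonpos (by linarith), mul_zero]
  have hhb : ∀ x, 0 ≤ h x ∧ h x ≤ a := fun x =>
    ⟨mul_nonneg ha.le (Real.smoothTransition.nonneg _),
      mul_le_of_le_one_right ha.le (Real.smoothTransition.le_one _)⟩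
  have hmono : Monotone g := monotone_of_hasDerivAt_nonneg hder fun x => (hhb x).1
  have hlin : ∀ x, x ≤ T → g x = a * x := by
    intro x hx
    have : g x = ∫ y in (0 : ℝ)..x, a := by
      refine intervalIntegral.integral_congr fun y hy => hh1 y ?_
      exact hy.2.trans (max_le (by linarith) hx)
    rw [this]
    simp [mul_comm]
  have hconst : ∀ x, T + 1 ≤ x → g x = g (T + 1) := by
    intro x hx
    have h1 : g x - g (T + 1) = ∫ y in (T + 1)..x, h y :=
      intervalIntegral.integral_interval_sub_left (hint _ _) (hint _ _)
    have h2 : ∫ y in (T + 1)..x, h y = ∫ y in (T + 1)..x, (0 : ℝ) := by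
      refine intervalIntegral.integral_congr fun y hy => hh0 y ?_
      rw [Set.uIcc_of_le hx] at hy
      exact hy.1
    rw [h2, intervalIntegral.integral_zero] at h1
    linarith
  have hR : a * T / l ≤ g (T + 1) / l := by
    rw [← hlin T le_rfl]
    exact div_le_div_of_nonneg_right (hmono (by linarith)) hl.le
  have hR' : T + R₀ + 2 ≤ g (T + 1) / l := by
    refine le_trans ?_ hR
    have : T * (a / l - 1) = a * T / l - T := by field_simp
    linarith
  refine ⟨g, g (T + 1) / l, by linarith, ?_, ?_, fun x hx => hlin x (hx.trans hT1), ?_⟩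
  · rw [contDiff_infty_iff_deriv, hderiv]
    exact ⟨fun x => (hder x).differentiableAt, hsm _⟩
  · rw [hderiv]; exact hhb
  · intro x hx
    have hx' : T + 1 ≤ x := by linarith
    refine ⟨?_, ?_⟩
    · rw [hconst x hx']; field_simp
    · rw [hderiv]; exact hh0 x hx'

end

/-! ### The nonlinearity with two affine equilibria. -/

section

variable {H : Type*} [NormedAddCommGroup H] [InnerProductSpace ℝ H] [CompleteSpace H]

namespace PosOp

variable (A : PosOp H)

/-- `p` solves `A p = F p` and `F` is affine near `p`, with linear part `K`. -/
def IsAffineEquilibrium (F : H → H) (p : H) (K : H →L[ℝ] H) : Prop :=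
  ∃ r > 0, ∀ v, ‖v‖ ≤ r → ∀ n,
    A.coeff n (F (p + v)) = A.eigenvalue n * A.coeff n p + A.coeff n (K v)

/-- A smooth map with Lipschitz constant `L` and two equilibria, near which it is affine with
prescribed weighted permutations as linear parts. -/
theorem exists_nonlinearity {a L : ℝ} (hl : A.eigenvalue 0 < a) (haL : a < L) {σ₀ σ₁ : ℕ → ℕ}
    (hσ₀ : Function.Injective σ₀) (hσ₁ : Function.Injective σ₁) {s₀ s₁ : ℕ → ℝ}
    (hs₀ : ∀ n, |s₀ n| ≤ a) (hs₁ : ∀ n, |s₁ n| ≤ a) (hσ : σ₁ 0 = 0) (hs : s₁ 0 = a) :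
    ∃ (F : H → H) (K₀ K₁ : H →L[ℝ] H) (R : ℝ),
      ContDiff ℝ ((⊤ : ℕ∞) : WithTop ℕ∞) F ∧ (∀ u v, ‖F u - F v‖ ≤ L * ‖u - v‖) ∧
      (∀ n u, A.coeff n (K₀ u) = s₀ n * A.coeff (σ₀ n) u) ∧
      (∀ n u, A.coeff n (K₁ u) = s₁ n * A.coeff (σ₁ n) u) ∧
      A.IsAffineEquilibrium F (R • A.basis 0) K₀ ∧ A.IsAffineEquilibrium F 0 K₁ := by
  have ha : 0 < a := (A.eigenvalue_pos 0).trans hl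
  obtain ⟨χ, r, R₀, hr, hR₀, hχs, hχ01, hχ1, hχ0, hχd⟩ :=
    exists_slow_cutoff H (δ := (L - a) / (2 * a)) (div_pos (by linarith) (by linarith))
  obtain ⟨g, R, hR, hgs, hgd, hg1, hgR⟩ := exists_smooth_plateau (R₀ := R₀) (A.eigenvalue_pos 0) hl
  obtain ⟨K₀, hK₀⟩ := A.exists_weightedPerm hσ₀ hs₀
  obtain ⟨K₁, hK₁⟩ := A.exists_weightedPerm hσ₁ hs₁
  -- `K` is `K₁` without its action on the first eigenvector; that action is replaced by the scalar
  -- function `g`. As `σ₁` fixes `0`, the first coordinate decouples from the others.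
  have hs' : ∀ n, |Function.update s₁ 0 0 n| ≤ a := by
    intro n
    rcases eq_or_ne n 0 with rfl | hn
    · simpa using ha.le
    · rw [Function.update_of_ne hn]; exact hs₁ n
  obtain ⟨K, hK⟩ := A.exists_weightedPerm hσ₁ hs'
  have hK_zero : ∀ u, A.coeff 0 (K u) = 0 := fun u => by rw [hK]; simp
  have hK_ne : ∀ n, n ≠ 0 → ∀ u, A.coeff n (K u) = s₁ n * A.coeff (σ₁ n) u := fun n hn u => by
    rw [hK, Function.update_of_ne hn]
  have hσne : ∀ n, n ≠ 0 → σ₁ n ≠ 0 := fun n hn h => hn (hσ₁ (h.trans hσ.symm))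
  have hKb : K (A.basis 0) = 0 := by
    apply A.coeff_ext
    intro n
    rw [A.coeff_zero]
    rcases eq_or_ne n 0 with rfl | hn
    · exact hK_zero _
    · rw [hK_ne n hn, A.coeff_basis, if_neg (hσne n hn), mul_zero]
  have hK₀b : ∀ u, ‖K₀ u‖ ≤ a * ‖u‖ := fun u => by
    refine A.norm_le_of_abs_coeff_le hσ₀ ha.le fun n => ?_
    rw [hK₀, abs_mul]
    exact mul_le_mul_of_nonneg_right (hs₀ n) (abs_nonneg _)
  have hKnorm : ∀ u, ‖K u‖ ≤ a * ‖u‖ := fun u => by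
    refine A.norm_le_of_abs_coeff_le hσ₁ ha.le fun n => ?_
    rw [hK, abs_mul]
    exact mul_le_mul_of_nonneg_right (hs' n) (abs_nonneg _)
  set p : H := R • A.basis 0 with hp
  have hpn : ‖p‖ = R := by
    rw [hp, norm_smul, A.basis.orthonormal.1 0, mul_one, Real.norm_of_nonneg (by linarith)]
  have hpc : A.coeff 0 p = R := by
    rw [hp, A.coeff_smul, A.coeff_basis, if_pos rfl, mul_one]
  have hKp : K p = 0 := by rw [hp, map_smul, hKb, smul_zero]
  -- The cutoff replaces `K` by `K₀` around `p`. There `g` has the constant value `λ * R` with `λ`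
  -- the first eigenvalue, exactly what makes `p` an equilibrium.
  set F : H → H := fun u => g (A.coeffL 0 u) • A.basis 0 + K u + χ (u - p) • (K₀ - K) (u - p)
    with hF
  refine ⟨F, K₀, K₁, R, ?_, ?_, hK₀, hK₁, ?_, ?_⟩
  · refine ((ContDiff.smul (hgs.comp (A.coeffL 0).contDiff) contDiff_const).add K.contDiff).add ?_
    have hsub : ContDiff ℝ ((⊤ : ℕ∞) : WithTop ℕ∞) fun u : H => u - p :=
      contDiff_id.sub contDiff_const
    exact (hχs.comp hsub).smul ((K₀ - K).contDiff.comp hsub)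
  · have hder : ∀ u, HasFDerivAt F
        ((deriv g (A.coeffL 0 u) • A.coeffL 0).smulRight (A.basis 0) + K +
          (χ (u - p) • (K₀ - K) + (fderiv ℝ χ (u - p)).smulRight ((K₀ - K) (u - p)))) u := by
      intro u
      have h1 : HasDerivAt g (deriv g (A.coeffL 0 u)) (A.coeffL 0 u) :=
        ((hgs.differentiable (by simp)) _).hasDerivAt
      have h2 := h1.comp_hasFDerivAt u (A.coeffL 0).hasFDerivAt
      have h3 : HasFDerivAt (fun u : H => u - p) (ContinuousLinearMap.id ℝ H) u :=
        (hasFDerivAt_id u).sub_const p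
      have h4 : HasFDerivAt χ (fderiv ℝ χ (u - p)) (u - p) :=
        ((hχs.differentiable (by simp)) _).hasFDerivAt
      have h5 := h4.comp u h3
      have h6 := (K₀ - K).hasFDerivAt.comp u h3
      exact ((h2.smul_const (A.basis 0)).add K.hasFDerivAt).add (h5.smul h6)
    have hbound : ∀ u, ‖fderiv ℝ F u‖ ≤ L := by
      intro u
      rw [(hder u).fderiv]
      refine ContinuousLinearMap.opNorm_le_bound _ (by linarith) fun η => ?_
      set v := u - p with hv
      have hsplit : ((deriv g (A.coeffL 0 u) • A.coeffL 0).smulRight (A.basis 0) + K +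
          (χ v • (K₀ - K) + (fderiv ℝ χ v).smulRight ((K₀ - K) v))) η =
          ((deriv g (A.coeff 0 u) * A.coeff 0 η) • A.basis 0 + K η + χ v • (K₀ η - K η)) +
            (fderiv ℝ χ v η) • (K₀ v - K v) := by
        simp [add_assoc]
      rw [hsplit]
      -- Outside the cutoff the derivative is a weighted permutation with weights at most `a`.
      -- Inside, `g` is on its plateau, and what remains is a convex combination of `K` and `K₀`.
      have hfirst : ‖(deriv g (A.coeff 0 u) * A.coeff 0 η) • A.basis 0 + K η +
          χ v • (K₀ η - K η)‖ ≤ a * ‖η‖ := by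
        rcases le_or_gt R₀ ‖v‖ with h | h
        · rw [hχ0 v h, zero_smul, add_zero]
          refine A.norm_le_of_abs_coeff_le hσ₁ ha.le fun n => ?_
          rw [A.coeff_add, A.coeff_smul, A.coeff_basis]
          rcases eq_or_ne n 0 with rfl | hn
          · rw [hK_zero, if_pos rfl, mul_one, add_zero, abs_mul, hσ, abs_of_nonneg (hgd _).1]
            exact mul_le_mul_of_nonneg_right (hgd _).2 (abs_nonneg _)
          · rw [if_neg hn, mul_zero, zero_add, hK_ne n hn, abs_mul]
            exact mul_le_mul_of_nonneg_right (hs₁ n) (abs_nonneg _)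
        · have h1 : R - R₀ - 1 ≤ A.coeff 0 u := by
            have h2 : A.coeff 0 u = R + A.coeff 0 v := by rw [hv, A.coeff_sub, hpc]; ring
            have h3 := (abs_le.1 (A.abs_coeff_le 0 v)).1
            linarith
          rw [(hgR _ h1).2, zero_mul, zero_smul, zero_add]
          have h2 : K η + χ v • (K₀ η - K η) = (1 - χ v) • K η + χ v • K₀ η := by
            rw [smul_sub, sub_smul, one_smul]; abel
          rw [h2]
          refine (norm_add_le _ _).trans ?_
          rw [norm_smul, norm_smul, Real.norm_of_nonneg (hχ01 v).1,
            Real.norm_of_nonneg (sub_nonneg.2 (hχ01 v).2)]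
          have h3 := mul_le_mul_of_nonneg_left (hKnorm η) (sub_nonneg.2 (hχ01 v).2)
          have h4 := mul_le_mul_of_nonneg_left (hK₀b η) (hχ01 v).1
          linarith
      -- The gradient of the cutoff costs at most `(L - a) / (2 * a)` times `2 * a`, which is the
      -- room between `a` and `L`.
      have hsecond : ‖(fderiv ℝ χ v η) • (K₀ v - K v)‖ ≤ (L - a) * ‖η‖ := by
        rw [norm_smul]
        have h1 : ‖K₀ v - K v‖ ≤ 2 * a * ‖v‖ :=
          (norm_sub_le _ _).trans (by linarith [hK₀b v, hKnorm v])
        calc ‖fderiv ℝ χ v η‖ * ‖K₀ v - K v‖ ≤ (‖fderiv ℝ χ v‖ * ‖η‖) * (2 * a * ‖v‖) :=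
              mul_le_mul ((fderiv ℝ χ v).le_opNorm η) h1 (norm_nonneg _) (by positivity)
          _ = (‖fderiv ℝ χ v‖ * ‖v‖) * (2 * a * ‖η‖) := by ring
          _ ≤ (L - a) / (2 * a) * (2 * a * ‖η‖) :=
              mul_le_mul_of_nonneg_right (hχd v) (by positivity)
          _ = (L - a) * ‖η‖ := by field_simp
      refine (norm_add_le _ _).trans ?_
      linarith
    intro u v
    exact convex_univ.norm_image_sub_le_of_norm_fderiv_le
      (fun x _ => (hder x).differentiableAt) (fun x _ => hbound x) (Set.mem_univ v)
      (Set.mem_univ u)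
  · refine ⟨min r 1, by positivity, fun v hv n => ?_⟩
    have h1 : R - R₀ - 1 ≤ A.coeff 0 (p + v) := by
      have h3 := (abs_le.1 (A.abs_coeff_le 0 v)).1
      have h4 := hv.trans (min_le_right _ _)
      rw [A.coeff_add, hpc]
      linarith
    have h2 : F (p + v) = A.eigenvalue 0 • p + K₀ v := by
      simp only [hF]
      rw [A.coeffL_apply, (hgR _ h1).1, add_sub_cancel_left, hχ1 v (hv.trans (min_le_left _ _)),
        map_add, hKp, one_smul, mul_smul, ← hp]
      simp [add_assoc]
    rw [h2, A.coeff_add, A.coeff_smul]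
    rcases eq_or_ne n 0 with rfl | hn
    · rfl
    · have : A.coeff n p = 0 := by rw [hp, A.coeff_smul, A.coeff_basis, if_neg hn, mul_zero]
      rw [this, mul_zero, mul_zero]
  · refine ⟨1, one_pos, fun v hv n => ?_⟩
    have h1 : A.coeff 0 v ≤ 1 := (le_abs_self _).trans ((A.abs_coeff_le 0 v).trans hv)
    have h2 : R₀ ≤ ‖v - p‖ := by
      have := norm_sub_norm_le p v
      rw [norm_sub_rev, hpn] at this
      linarith
    simp only [hF]
    rw [zero_add, A.coeffL_apply, hg1 _ h1, hχ0 _ h2, zero_smul, add_zero, A.coeff_zero, mul_zero,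
      zero_add, A.coeff_add, A.coeff_smul, A.coeff_basis, hK₁]
    rcases eq_or_ne n 0 with rfl | hn
    · rw [hK_zero, if_pos rfl, hσ, hs]; ring
    · rw [if_neg hn, hK_ne n hn]; ring

end PosOp

end

/-! ### Uniqueness of solutions, and derivatives along segments. -/

section

/-- A quantity vanishes if it is dominated by a family of energies which start at zero and whose
growth rates it controls. -/
theorem eq_zero_of_truncated_energies {T C b : ℝ} (hC : 0 ≤ C) (hb : 0 < b)
    {D : ℝ → ℝ} {e e' : ℕ → ℝ → ℝ} (hDc : ContinuousOn D (Set.Icc 0 T))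
    (hD0 : ∀ t, 0 ≤ D t) (he0 : ∀ M, e M 0 = 0)
    (hder : ∀ M, ∀ t ∈ Set.Icc 0 T, HasDerivWithinAt (e M) (e' M t) (Set.Icc 0 T) t)
    (hle : ∀ M, ∀ t ∈ Set.Icc 0 T, e' M t ≤ C * D t)
    (hdom : ∀ t ∈ Set.Icc 0 T, ∀ x, (∀ M, e M t ≤ x) → b * D t ≤ x) :
    ∀ t ∈ Set.Icc 0 T, D t = 0 := by
  intro t₀ ht₀
  have hT : 0 ≤ T := ht₀.1.trans ht₀.2
  -- Any `c` with `C / c < b` would do.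
  set c : ℝ := C / b + 1 with hc
  have hc0 : 0 < c := by positivity
  have hCc : C < b * c := by
    have : b * c = C + b := by rw [hc]; field_simp
    linarith
  obtain ⟨τ, hτ, hmax⟩ := isCompact_Icc.exists_isMaxOn ⟨t₀, ht₀⟩
    (f := fun t => Real.exp (-c * t) * D t)
    (((Real.continuous_exp.comp (continuous_const.mul continuous_id)).continuousOn).mul hDc)
  set m := Real.exp (-c * τ) * D τ with hm
  have hexp : ∀ t, Real.exp (c * t) * Real.exp (-c * t) = 1 := fun t => by
    rw [← Real.exp_add]; simp
  have hDm : ∀ t ∈ Set.Icc 0 T, D t ≤ m * Real.exp (c * t) := by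
    intro t ht
    have h1 : Real.exp (-c * t) * D t ≤ m := hmax ht
    have h2 := mul_le_mul_of_nonneg_left h1 (Real.exp_nonneg (c * t))
    rw [← mul_assoc, hexp, one_mul] at h2
    linarith
  have hm0 : 0 ≤ m := mul_nonneg (Real.exp_nonneg _) (hD0 τ)
  -- At the maximum point `τ` of `exp (-c * t) * D t`, integrating `e' ≤ C * D` bounds all energies
  -- by `C * m / c * exp (c * τ)`. Domination then yields `b * m ≤ C * m / c`, so `m = 0`. The
  -- quantity `D` itself is never differentiated.
  have hen : ∀ M, e M τ ≤ C * m / c * Real.exp (c * τ) := by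
    intro M
    have hd : ∀ t ∈ Set.Icc 0 T, HasDerivWithinAt
        (fun s => e M s - C * m / c * Real.exp (c * s))
        (e' M t - C * m / c * (Real.exp (c * t) * (c * 1))) (Set.Icc 0 T) t := fun t ht =>
      (hder M t ht).sub ((((hasDerivAt_id t).const_mul c).exp).const_mul _).hasDerivWithinAt
    have hanti := antitoneOn_of_hasDerivWithinAt_nonpos (convex_Icc 0 T)
      (fun t ht => (hd t ht).continuousWithinAt)
      (fun t ht => (hd t (interior_subset ht)).mono interior_subset) (fun t ht => by
        have h1 := hle M t (interior_subset ht)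
        have h2 := mul_le_mul_of_nonneg_left (hDm t (interior_subset ht)) hC
        have h3 : C * m / c * (Real.exp (c * t) * (c * 1)) = C * (m * Real.exp (c * t)) := by
          field_simp
        linarith)
    have h4 := hanti ⟨le_rfl, hT⟩ hτ hτ.1
    have h5 : 0 ≤ C * m / c * Real.exp (c * 0) := by positivity
    simp only [he0] at h4
    linarith
  have h6 := hdom τ hτ _ hen
  have h7 : D τ = m * Real.exp (c * τ) := by
    have := hexp τ
    calc D τ = Real.exp (c * τ) * Real.exp (-c * τ) * D τ := by rw [this, one_mul]
      _ = _ := by rw [hm]; ring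
  have h8 : m = 0 := by
    rw [h7, ← mul_assoc] at h6
    have h9 := le_of_mul_le_mul_right h6 (Real.exp_pos _)
    rw [le_div_iff₀ hc0] at h9
    nlinarith
  have h10 := hDm t₀ ht₀
  rw [h8, zero_mul] at h10
  exact le_antisymm h10 (hD0 t₀)

variable {H : Type*} [NormedAddCommGroup H] [InnerProductSpace ℝ H] [CompleteSpace H]

namespace PosOp

variable (A : PosOp H)

theorem eigenvalue_zero_mul_norm_sq_le {w : H} {x : ℝ}
    (h : ∀ M, ∑ n ∈ Finset.range M, A.eigenvalue n * A.coeff n w ^ 2 ≤ x) :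
    A.eigenvalue 0 * ‖w‖ ^ 2 ≤ x := by
  rw [A.norm_sq_eq_tsum, ← tsum_mul_left]
  refine Real.tsum_le_of_sum_range_le (fun n => ?_) fun M => le_trans ?_ (h M)
  · exact mul_nonneg (A.eigenvalue_pos 0).le (sq_nonneg _)
  · exact Finset.sum_le_sum fun n _ =>
      mul_le_mul_of_nonneg_right (A.eigenvalue_mono (Nat.zero_le n)) (sq_nonneg _)

theorem sum_coeff_sub_sq_le {F : H → H} {L : ℝ} (hF : ∀ u v, ‖F u - F v‖ ≤ L * ‖u - v‖)
    (M : ℕ) (u v : H) :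
    ∑ n ∈ Finset.range M, (A.coeff n (F u) - A.coeff n (F v)) ^ 2 ≤ L ^ 2 * ‖u - v‖ ^ 2 := by
  simp only [← A.coeff_sub]
  refine (A.sum_coeff_sq_le _ _).trans ?_
  rw [← mul_pow]
  exact pow_le_pow_left₀ (norm_nonneg _) (hF u v) 2

/-- Uniqueness for the damped wave equation, in Fourier coordinates. -/
theorem hyperbolic_unique {ε L T : ℝ} (hε : 0 < ε) {F : H → H}
    (hF : ∀ u v, ‖F u - F v‖ ≤ L * ‖u - v‖) {u v u' v' : ℝ → H}
    (hu : ∀ t ∈ Set.Icc 0 T, HasDerivWithinAt u (v t) (Set.Icc 0 T) t)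
    (hv : ∀ n, ∀ t ∈ Set.Icc 0 T, HasDerivWithinAt (fun s => ε * A.coeff n (v s))
      (A.coeff n (F (u t)) - A.coeff n (v t) - A.eigenvalue n * A.coeff n (u t)) (Set.Icc 0 T) t)
    (hu' : ∀ t ∈ Set.Icc 0 T, HasDerivWithinAt u' (v' t) (Set.Icc 0 T) t)
    (hv' : ∀ n, ∀ t ∈ Set.Icc 0 T, HasDerivWithinAt (fun s => ε * A.coeff n (v' s))
      (A.coeff n (F (u' t)) - A.coeff n (v' t) - A.eigenvalue n * A.coeff n (u' t))
      (Set.Icc 0 T) t)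
    (h0 : u 0 = u' 0) (h0' : v 0 = v' 0) : ∀ t ∈ Set.Icc 0 T, u t = u' t := by
  -- Truncations of the standard energy of the difference, written with `ε * v`, the quantity whose
  -- derivative the weak equation supplies. The damping absorbs the velocity: `2 * x * y - 2 * x ^ 2
  -- ≤ y ^ 2`.
  have key := eq_zero_of_truncated_energies (T := T) (C := L ^ 2) (b := A.eigenvalue 0)
    (D := fun t => ‖u t - u' t‖ ^ 2)
    (e := fun M t => ∑ n ∈ Finset.range M,
      (ε⁻¹ * (ε * A.coeff n (v t) - ε * A.coeff n (v' t)) ^ 2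
        + A.eigenvalue n * (A.coeff n (u t) - A.coeff n (u' t)) ^ 2))
    (e' := fun M t => ∑ n ∈ Finset.range M,
      (2 * (A.coeff n (v t) - A.coeff n (v' t)) * (A.coeff n (F (u t)) - A.coeff n (F (u' t)))
        - 2 * (A.coeff n (v t) - A.coeff n (v' t)) ^ 2))
    (sq_nonneg L) (A.eigenvalue_pos 0) ?_ (fun t => sq_nonneg _) ?_ ?_ ?_ ?_
  · intro t ht
    have := key t ht
    exact sub_eq_zero.1 (norm_eq_zero.1 (pow_eq_zero_iff two_ne_zero |>.1 this))
  · exact (ContinuousOn.norm fun t ht =>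
      ((hu t ht).continuousWithinAt.sub (hu' t ht).continuousWithinAt)).pow 2
  · intro M
    simp [h0, h0']
  · intro M t ht
    refine HasDerivWithinAt.fun_sum fun n _ => ?_
    have h1 := ((((hv n t ht).sub (hv' n t ht)).pow 2).const_mul ε⁻¹)
    have hc : HasDerivWithinAt (fun s => A.coeff n (u s)) (A.coeff n (v t)) (Set.Icc 0 T) t :=
      (A.coeffL n).hasFDerivAt.comp_hasDerivWithinAt t (hu t ht)
    have hc' : HasDerivWithinAt (fun s => A.coeff n (u' s)) (A.coeff n (v' t)) (Set.Icc 0 T) t :=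
      (A.coeffL n).hasFDerivAt.comp_hasDerivWithinAt t (hu' t ht)
    have h2 := (((hc.sub hc').pow 2).const_mul (A.eigenvalue n))
    refine (h1.add h2).congr_deriv ?_
    simp only [Pi.sub_apply]
    push_cast
    field_simp
    ring
  · intro M t _
    refine le_trans (Finset.sum_le_sum fun n _ => ?_) (A.sum_coeff_sub_sq_le hF M (u t) (u' t))
    nlinarith [sq_nonneg (A.coeff n (v t) - A.coeff n (v' t)
      - (A.coeff n (F (u t)) - A.coeff n (F (u' t)))), sq_nonneg (A.coeff n (v t) - A.coeff n (v' t))]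
  · intro t _ x hx
    refine A.eigenvalue_zero_mul_norm_sq_le fun M => le_trans (Finset.sum_le_sum fun n _ => ?_)
      (hx M)
    rw [A.coeff_sub]
    have : 0 ≤ ε⁻¹ * (ε * A.coeff n (v t) - ε * A.coeff n (v' t)) ^ 2 := by positivity
    linarith

/-- Uniqueness for the semilinear heat equation, in Fourier coordinates. -/
theorem parabolic_unique {L T : ℝ} {F : H → H}
    (hF : ∀ u v, ‖F u - F v‖ ≤ L * ‖u - v‖) {u u' : ℝ → H}
    (hu : ContinuousOn u (Set.Icc 0 T)) (hu' : ContinuousOn u' (Set.Icc 0 T))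
    (hv : ∀ n, ∀ t ∈ Set.Icc 0 T, HasDerivWithinAt (fun s => A.coeff n (u s))
      (A.coeff n (F (u t)) - A.eigenvalue n * A.coeff n (u t)) (Set.Icc 0 T) t)
    (hv' : ∀ n, ∀ t ∈ Set.Icc 0 T, HasDerivWithinAt (fun s => A.coeff n (u' s))
      (A.coeff n (F (u' t)) - A.eigenvalue n * A.coeff n (u' t)) (Set.Icc 0 T) t)
    (h0 : u 0 = u' 0) : ∀ t ∈ Set.Icc 0 T, u t = u' t := by
  -- Here `2 * x * y ≤ x ^ 2 + y ^ 2` gives the constant `1 + L ^ 2`; the term with the eigenvalue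
  -- has a favourable sign.
  have key := eq_zero_of_truncated_energies (T := T) (C := 1 + L ^ 2) (b := 1)
    (D := fun t => ‖u t - u' t‖ ^ 2)
    (e := fun M t => ∑ n ∈ Finset.range M, (A.coeff n (u t) - A.coeff n (u' t)) ^ 2)
    (e' := fun M t => ∑ n ∈ Finset.range M,
      2 * (A.coeff n (u t) - A.coeff n (u' t)) *
        (A.coeff n (F (u t)) - A.coeff n (F (u' t))
          - A.eigenvalue n * (A.coeff n (u t) - A.coeff n (u' t))))
    (by positivity) one_pos ?_ (fun t => sq_nonneg _) ?_ ?_ ?_ ?_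
  · intro t ht
    have := key t ht
    exact sub_eq_zero.1 (norm_eq_zero.1 (pow_eq_zero_iff two_ne_zero |>.1 this))
  · exact ((hu.sub hu').norm).pow 2
  · intro M
    simp [h0]
  · intro M t ht
    refine HasDerivWithinAt.fun_sum fun n _ => ?_
    refine (((hv n t ht).sub (hv' n t ht)).pow 2).congr_deriv ?_
    simp only [Pi.sub_apply]
    push_cast
    ring
  · intro M t _
    have h1 := A.sum_coeff_sub_sq_le hF M (u t) (u' t)
    have h2 := A.sum_coeff_sq_le (Finset.range M) (u t - u' t)
    simp only [A.coeff_sub] at h2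
    have h3 := add_le_add h2 h1
    rw [← Finset.sum_add_distrib] at h3
    refine le_trans (Finset.sum_le_sum fun n _ => ?_) (h3.trans (by linarith))
    have h4 : 0 ≤ A.eigenvalue n * (A.coeff n (u t) - A.coeff n (u' t)) ^ 2 :=
      mul_nonneg (A.eigenvalue_pos n).le (sq_nonneg _)
    nlinarith [sq_nonneg (A.coeff n (u t) - A.coeff n (u' t)
      - (A.coeff n (F (u t)) - A.coeff n (F (u' t))))]
  · intro t _ x hx
    rw [one_mul, A.norm_sq_eq_tsum]
    refine Real.tsum_le_of_sum_range_le (fun n => sq_nonneg _) fun M => ?_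
    simpa only [A.coeff_sub] using hx M

end PosOp

theorem fderiv_apply_eq_of_forall_small {X : Type*} [NormedAddCommGroup X] [NormedSpace ℝ X]
    {G : X → X} {ξ η ζ : X} (hG : DifferentiableAt ℝ G ξ)
    (h : ∃ δ > 0, ∀ x : ℝ, |x| < δ → G (ξ + x • η) = ξ + x • ζ) : fderiv ℝ G ξ η = ζ := by
  obtain ⟨δ, hδ, h⟩ := h
  have hl : HasDerivAt (fun x : ℝ => ξ + x • η) η 0 := by
    simpa using ((hasDerivAt_id (0 : ℝ)).smul_const η).const_add ξ
  have hl' : HasDerivAt (fun x : ℝ => ξ + x • ζ) ζ 0 := by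
    simpa using ((hasDerivAt_id (0 : ℝ)).smul_const ζ).const_add ξ
  have h0 : ξ + (0 : ℝ) • η = ξ := by simp
  have h1 : HasDerivAt (fun x : ℝ => G (ξ + x • η)) (fderiv ℝ G ξ η) 0 := by
    refine HasFDerivAt.comp_hasDerivAt 0 ?_ hl
    rw [h0]
    exact hG.hasFDerivAt
  refine h1.unique (hl'.congr_of_eventuallyEq ?_)
  filter_upwards [Metric.ball_mem_nhds (0 : ℝ) hδ] with x hx
  exact h x (by simpa using hx)

end

/-! ### Explicit solutions near an affine equilibrium. -/

section

variable {H : Type*} [NormedAddCommGroup H] [InnerProductSpace ℝ H] [CompleteSpace H]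

namespace PosOp

variable (A : PosOp H)

theorem coeff_neg (n : ℕ) (u : H) : A.coeff n (-u) = -A.coeff n u := inner_neg_right _ _

theorem incl_injective : Function.Injective A.incl := Subtype.val_injective

/-- `Z` parametrizes an eigenspace of `A - K` (with eigenvalue `ν`) by the real parts of complex
eigenvectors. -/
def IsMode (K : H →L[ℝ] H) (ν : ℂ) (Z : ℂ →ₗ[ℝ] A.H1) : Prop :=
  ∀ c n, A.eigenvalue n * A.coeff n (A.incl (Z c)) - A.coeff n (K (A.incl (Z c))) =
    A.coeff n (A.incl (Z (ν * c)))

/-- The position component of the linearized solutions as a continuous map. -/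
def modeL (Z : ℂ →ₗ[ℝ] A.H1) : ℂ →L[ℝ] H := LinearMap.toContinuousLinearMap (A.incl ∘ₗ Z)

theorem modeL_apply (Z : ℂ →ₗ[ℝ] A.H1) (c : ℂ) : A.modeL Z c = A.incl (Z c) := rfl

theorem hasDerivAt_exp_mul (μ c : ℂ) (t : ℝ) :
    HasDerivAt (fun s : ℝ => Complex.exp (-μ * s) * c) (-μ * (Complex.exp (-μ * t) * c)) t := by
  have h1 : HasDerivAt (fun s : ℂ => Complex.exp (-μ * s) * c)
      (Complex.exp (-μ * t) * (-μ * 1) * c) (t : ℂ) :=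
    (((hasDerivAt_id (t : ℂ)).const_mul (-μ)).cexp).mul_const c
  exact h1.comp_ofReal.congr_deriv (by ring)

theorem hasDerivAt_modeL (Z : ℂ →ₗ[ℝ] A.H1) (μ c : ℂ) (t : ℝ) :
    HasDerivAt (fun s : ℝ => A.modeL Z (Complex.exp (-μ * s) * c))
      (A.modeL Z (-μ * (Complex.exp (-μ * t) * c))) t :=
  (A.modeL Z).hasFDerivAt.comp_hasDerivAt t (hasDerivAt_exp_mul μ c t)

theorem exists_small_modeL (Z : ℂ →ₗ[ℝ] A.H1) (μ c : ℂ) (T : ℝ) {r : ℝ} (hr : 0 < r) :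
    ∃ δ > 0, ∀ x : ℝ, |x| < δ → ∀ t ∈ Set.Icc 0 T,
      ‖x • A.modeL Z (Complex.exp (-μ * t) * c)‖ ≤ r := by
  obtain ⟨B, hB⟩ := isCompact_Icc.exists_bound_of_continuousOn (s := Set.Icc 0 T)
    (f := fun s : ℝ => A.modeL Z (Complex.exp (-μ * s) * c))
    (fun t _ => (A.hasDerivAt_modeL Z μ c t).continuousAt.continuousWithinAt)
  refine ⟨r / (|B| + 1), by positivity, fun x hx t ht => ?_⟩
  rw [norm_smul, Real.norm_eq_abs]
  rw [lt_div_iff₀ (by positivity)] at hx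
  have h1 : ‖A.modeL Z (Complex.exp (-μ * t) * c)‖ ≤ |B| + 1 :=
    (hB t ht).trans (by linarith [le_abs_self B])
  exact (mul_le_mul_of_nonneg_left h1 (abs_nonneg x)).trans hx.le

/-- Along a mode the nonlinear vector field reduces to multiplication of the complex coordinate by
`-ν`. -/
theorem coeff_affine {F : H → H} {p : H} {K : H →L[ℝ] H} {ν : ℂ} {Z : ℂ →ₗ[ℝ] A.H1} {r : ℝ}
    (hr : ∀ v, ‖v‖ ≤ r → ∀ n,
      A.coeff n (F (p + v)) = A.eigenvalue n * A.coeff n p + A.coeff n (K v))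
    (hZ : A.IsMode K ν Z) (x : ℝ) (c : ℂ) (h : ‖x • A.modeL Z c‖ ≤ r) (n : ℕ) :
    A.coeff n (F (p + x • A.modeL Z c)) - A.eigenvalue n * A.coeff n (p + x • A.modeL Z c) =
      -(x * A.coeff n (A.modeL Z (ν * c))) := by
  have h1 := hZ c n
  rw [hr _ h, map_smul, A.coeff_smul, A.coeff_add, A.coeff_smul]
  simp only [modeL_apply]
  linear_combination -x * h1

theorem coeff_eq_inner (n : ℕ) (u : H) : inner ℝ u (A.basis n) = A.coeff n u :=
  real_inner_comm _ _

section Hyperbolic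

variable {ε : ℝ}

/-- The phase space points of the linearized solutions of the damped wave equation. -/
def phaseMode (ε : ℝ) (Z : ℂ →ₗ[ℝ] A.H1) (μ : ℂ) : ℂ →ₗ[ℝ] A.Energy ε where
  toFun c := (Z c, A.incl (Z (-μ * c)))
  map_add' c d := by rw [mul_add, map_add, map_add, map_add]; rfl
  map_smul' x c := by
    rw [mul_smul_comm, map_smul, map_smul, map_smul]; rfl

/-- A point of `H¹` at rest. -/
def rest (ε : ℝ) (p : A.H1) : A.Energy ε := (p, (0 : H))

theorem energy_ext {ξ η : A.Energy ε} (h1 : A.pos ε ξ = A.pos ε η)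
    (h2 : A.vel ε ξ = A.vel ε η) : ξ = η :=
  Prod.ext (Subtype.ext h1) h2

/-- The curve `p + x • Z (exp (-μ * s) * c)` solves the equation while it stays in the ball where
`F` is affine. A small `x` ensures this on a compact time interval, and uniqueness does the rest. -/
theorem hyperbolic_local {L : ℝ} (hε : 0 < ε) {F : H → H}
    (hF : ∀ u v, ‖F u - F v‖ ≤ L * ‖u - v‖) {S : ℝ → A.Energy ε → A.Energy ε}
    (hS : A.IsHyperbolicSemigroup ε F S) {p : A.H1} {K : H →L[ℝ] H}
    (hp : A.IsAffineEquilibrium F (A.incl p) K) {ν μ : ℂ} {Z : ℂ →ₗ[ℝ] A.H1}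
    (hZ : A.IsMode K ν Z) (hμ : ε * μ ^ 2 - μ + ν = 0) {t : ℝ} (ht : 0 ≤ t) (c : ℂ) :
    ∃ δ > 0, ∀ x : ℝ, |x| < δ → S t (A.rest ε p + x • A.phaseMode ε Z μ c) =
      A.rest ε p + x • A.phaseMode ε Z μ (Complex.exp (-μ * t) * c) := by
  obtain ⟨r, hr, hK⟩ := hp
  -- The time `t + 1` keeps the interval nondegenerate even for `t = 0`, so that one-sided
  -- derivatives at `t` are unique and the velocities agree too.
  obtain ⟨δ, hδ, hsmall⟩ := A.exists_small_modeL Z μ c (t + 1) hr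
  refine ⟨δ, hδ, fun x hx => ?_⟩
  set ξ := A.rest ε p + x • A.phaseMode ε Z μ c with hξ
  set w : ℝ → ℂ := fun s => Complex.exp (-μ * s) * c with hw
  have hw0 : w 0 = c := by simp [hw]
  have hu : ∀ s ∈ Set.Icc 0 (t + 1), HasDerivWithinAt (fun s => A.pos ε (S s ξ))
      (A.vel ε (S s ξ)) (Set.Icc 0 (t + 1)) s := fun s hs =>
    (hS.velocity ξ s hs.1).mono Set.Icc_subset_Ici_self
  have hu' : ∀ s ∈ Set.Icc 0 (t + 1), HasDerivWithinAt (fun s => A.incl p + x • A.modeL Z (w s))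
      (x • A.modeL Z (-μ * w s)) (Set.Icc 0 (t + 1)) s := fun s _ =>
    (((A.hasDerivAt_modeL Z μ c s).const_smul x).const_add _).hasDerivWithinAt
  have hpos0 : A.pos ε (S 0 ξ) = A.incl p + x • A.modeL Z (w 0) := by
    rw [hS.init, hw0, hξ, map_add, map_smul]; rfl
  have hvel0 : A.vel ε (S 0 ξ) = x • A.modeL Z (-μ * w 0) := by
    rw [hS.init, hw0, hξ, map_add, map_smul]
    exact zero_add _
  have heq := A.hyperbolic_unique hε hF hu (v' := fun s => x • A.modeL Z (-μ * w s)) ?_ hu' ?_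
    hpos0 hvel0
  · have htI : t ∈ Set.Icc 0 (t + 1) := ⟨ht, by linarith⟩
    have hvel : A.vel ε (S t ξ) = x • A.modeL Z (-μ * w t) := by
      refine (uniqueDiffOn_Icc (by linarith) t htI).eq_deriv _ (hu t htI) ?_
      exact (hu' t htI).congr heq (heq t htI)
    refine A.energy_ext ?_ ?_
    · rw [heq t htI, map_add, map_smul]; rfl
    · rw [hvel, map_add, map_smul]
      exact (zero_add _).symm
  · intro n s hs
    obtain ⟨hd, hAn⟩ := A.eigen n
    have h1 := (hS.equation ξ ⟨A.basis n, hd⟩ s hs.1).mono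
      (Set.Icc_subset_Ici_self (b := 0) (a := t + 1))
    rw [hAn, inner_smul_right] at h1
    simpa only [A.coeff_eq_inner] using h1
  · intro n s hs
    have h1 : HasDerivAt (fun s : ℝ => -μ * w s) (-μ * (-μ * w s)) s :=
      (hasDerivAt_exp_mul μ c s).const_mul (-μ)
    have h2 := ((A.coeffL n).hasFDerivAt.comp_hasDerivAt s
      (((A.modeL Z).hasFDerivAt.comp_hasDerivAt s h1).const_smul x)).const_mul ε
    refine (h2.congr_deriv ?_).hasDerivWithinAt
    have h3 := A.coeff_affine hK hZ x (w s) (hsmall x hx s hs) n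
    have h4 : A.modeL Z (ν * w s) = A.modeL Z (μ * w s) - ε • A.modeL Z (μ * (μ * w s)) := by
      rw [← map_smul, ← map_sub]
      congr 1
      rw [Complex.real_smul]
      linear_combination (w s) * hμ
    rw [h4, A.coeff_sub, A.coeff_smul] at h3
    simp only [neg_mul, map_neg, mul_neg, neg_neg, smul_neg, map_smul, smul_eq_mul,
      coeffL_apply] at h3 ⊢
    rw [A.coeff_neg, A.coeff_smul]
    linarith

theorem hyperbolic_fixed {L : ℝ} (hε : 0 < ε) {F : H → H}
    (hF : ∀ u v, ‖F u - F v‖ ≤ L * ‖u - v‖) {S : ℝ → A.Energy ε → A.Energy ε}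
    (hS : A.IsHyperbolicSemigroup ε F S) {p : A.H1} {K : H →L[ℝ] H}
    (hp : A.IsAffineEquilibrium F (A.incl p) K) {t : ℝ} (ht : 0 ≤ t) :
    S t (A.rest ε p) = A.rest ε p := by
  -- The zero map is a mode, and its solution is the equilibrium itself.
  obtain ⟨δ, hδ, h⟩ := A.hyperbolic_local hε hF hS hp (ν := 0) (μ := 0) (Z := 0)
    (fun c n => by simp) (by simp) ht 0
  simpa using h 0 (by simpa using hδ)

theorem hyperbolic_fderiv {L : ℝ} (hε : 0 < ε) {F : H → H}
    (hF : ∀ u v, ‖F u - F v‖ ≤ L * ‖u - v‖) {S : ℝ → A.Energy ε → A.Energy ε}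
    (hS : A.IsHyperbolicSemigroup ε F S) {p : A.H1} {K : H →L[ℝ] H}
    (hp : A.IsAffineEquilibrium F (A.incl p) K) {ν μ : ℂ} {Z : ℂ →ₗ[ℝ] A.H1}
    (hZ : A.IsMode K ν Z) (hμ : ε * μ ^ 2 - μ + ν = 0) {t : ℝ} (ht : 0 ≤ t)
    (hd : DifferentiableAt ℝ (S t) (A.rest ε p)) (c : ℂ) :
    fderiv ℝ (S t) (A.rest ε p) (A.phaseMode ε Z μ c) =
      A.phaseMode ε Z μ (Complex.exp (-μ * t) * c) :=
  fderiv_apply_eq_of_forall_small hd (A.hyperbolic_local hε hF hS hp hZ hμ ht c)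

theorem norm_rest (p : A.H1) : ‖A.rest ε p‖ = ‖p‖ := by
  have h1 : ‖A.rest ε p‖ = ‖A.energyCoord ε (A.rest ε p)‖ := rfl
  have h2 : ‖p‖ = ‖A.sqrtCoord p‖ := rfl
  have h3 : (A.energyCoord ε (A.rest ε p)).fst = A.sqrtCoord p := rfl
  have h4 : (A.energyCoord ε (A.rest ε p)).snd.fst = √ε • (0 : H) := rfl
  have h5 : (A.energyCoord ε (A.rest ε p)).snd.snd = A.invSqrtCoord 0 := rfl
  have h6 := WithLp.prod_norm_sq_eq_of_L2 (A.energyCoord ε (A.rest ε p))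
  rw [WithLp.prod_norm_sq_eq_of_L2 (A.energyCoord ε (A.rest ε p)).snd, h3, h4, h5] at h6
  rw [h1, h2]
  refine (pow_left_inj₀ (norm_nonneg _) (norm_nonneg _) two_ne_zero).1 ?_
  rw [h6]
  simp

end Hyperbolic

section Parabolic

theorem norm_incl_le (u : A.H1) : ‖A.incl u‖ ≤ (√(A.eigenvalue 0))⁻¹ * ‖u‖ := by
  have h0 := A.eigenvalue_pos 0
  have hs : Summable fun n => A.eigenvalue n * A.coeff n (A.incl u) ^ 2 := by
    refine (Seq2.summable_sq (A.sqrtCoord u)).congr fun n => ?_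
    have h1 : A.sqrtCoord u n = √(A.eigenvalue n) * A.coeff n (A.incl u) := rfl
    rw [h1, mul_pow, Real.sq_sqrt (A.eigenvalue_pos n).le]
  have h1 : A.eigenvalue 0 * ‖A.incl u‖ ^ 2 ≤ ‖u‖ ^ 2 := by
    rw [A.H1_norm_sq]
    exact A.eigenvalue_zero_mul_norm_sq_le fun M => hs.sum_le_tsum _ fun n _ =>
      mul_nonneg (A.eigenvalue_pos n).le (sq_nonneg _)
  refine (abs_le_of_sq_le_sq' ?_ (by positivity)).2
  rw [mul_pow, inv_pow, Real.sq_sqrt h0.le, inv_mul_eq_div, le_div_iff₀ h0]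
  linarith

/-- The inclusion `H¹ → H` as a continuous map. -/
def inclL : A.H1 →L[ℝ] H := A.incl.mkContinuous _ A.norm_incl_le

theorem parabolic_local {L : ℝ} {F : H → H}
    (hF : ∀ u v, ‖F u - F v‖ ≤ L * ‖u - v‖) {S : ℝ → A.H1 → A.H1}
    (hS : A.IsParabolicSemigroup F S) {p : A.H1} {K : H →L[ℝ] H}
    (hp : A.IsAffineEquilibrium F (A.incl p) K) {ν : ℂ} {Z : ℂ →ₗ[ℝ] A.H1}
    (hZ : A.IsMode K ν Z) {t : ℝ} (ht : 0 ≤ t) (c : ℂ) :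
    ∃ δ > 0, ∀ x : ℝ, |x| < δ → S t (p + x • Z c) =
      p + x • Z (Complex.exp (-ν * t) * c) := by
  obtain ⟨r, hr, hK⟩ := hp
  obtain ⟨δ, hδ, hsmall⟩ := A.exists_small_modeL Z ν c t hr
  refine ⟨δ, hδ, fun x hx => ?_⟩
  set ξ := p + x • Z c with hξ
  set w : ℝ → ℂ := fun s => Complex.exp (-ν * s) * c with hw
  have hw0 : w 0 = c := by simp [hw]
  have hc : ContinuousOn (fun s => A.incl (S s ξ)) (Set.Icc 0 t) :=
    A.inclL.continuous.comp_continuousOn ((hS.cont ξ).mono Set.Icc_subset_Ici_self)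
  have hu' : ∀ s, HasDerivAt (fun s => A.incl p + x • A.modeL Z (w s))
      (x • A.modeL Z (-ν * w s)) s := fun s =>
    ((A.hasDerivAt_modeL Z ν c s).const_smul x).const_add _
  have hpos0 : A.incl (S 0 ξ) = A.incl p + x • A.modeL Z (w 0) := by
    rw [hS.init, hw0, hξ, map_add, map_smul]; rfl
  have heq := A.parabolic_unique hF hc
    (fun s _ => (hu' s).continuousAt.continuousWithinAt) ?_ ?_ hpos0
  · have htI : t ∈ Set.Icc 0 t := ⟨ht, le_rfl⟩
    apply A.incl_injective
    rw [heq t htI, map_add, map_smul]; rfl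
  · intro n s hs
    obtain ⟨hd, hAn⟩ := A.eigen n
    have h1 := (hS.equation ξ ⟨A.basis n, hd⟩ s hs.1).mono
      (Set.Icc_subset_Ici_self (b := 0) (a := t))
    rw [hAn, inner_smul_right] at h1
    simpa only [A.coeff_eq_inner] using h1
  · intro n s hs
    have h2 := (A.coeffL n).hasFDerivAt.comp_hasDerivAt s (hu' s)
    refine (h2.congr_deriv ?_).hasDerivWithinAt
    rw [A.coeff_affine hK hZ x (w s) (hsmall x hx s hs) n]
    simp [A.coeff_neg, A.coeff_smul]

theorem parabolic_fixed {L : ℝ} {F : H → H}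
    (hF : ∀ u v, ‖F u - F v‖ ≤ L * ‖u - v‖) {S : ℝ → A.H1 → A.H1}
    (hS : A.IsParabolicSemigroup F S) {p : A.H1} {K : H →L[ℝ] H}
    (hp : A.IsAffineEquilibrium F (A.incl p) K) {t : ℝ} (ht : 0 ≤ t) : S t p = p := by
  obtain ⟨δ, hδ, h⟩ := A.parabolic_local hF hS hp (ν := 0) (Z := 0) (fun c n => by simp) ht 0
  simpa using h 0 (by simpa using hδ)

theorem parabolic_fderiv {L : ℝ} {F : H → H}
    (hF : ∀ u v, ‖F u - F v‖ ≤ L * ‖u - v‖) {S : ℝ → A.H1 → A.H1}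
    (hS : A.IsParabolicSemigroup F S) {p : A.H1} {K : H →L[ℝ] H}
    (hp : A.IsAffineEquilibrium F (A.incl p) K) {ν : ℂ} {Z : ℂ →ₗ[ℝ] A.H1}
    (hZ : A.IsMode K ν Z) {t : ℝ} (ht : 0 ≤ t)
    (hd : DifferentiableAt ℝ (S t) p) (c : ℂ) :
    fderiv ℝ (S t) p (Z c) = Z (Complex.exp (-ν * t) * c) :=
  fderiv_apply_eq_of_forall_small hd (A.parabolic_local hF hS hp hZ ht c)

end Parabolic

end PosOp

end

/-! ### Nonreal decay rates and totality of the modes. -/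

section

/-- The variant of `even_finrank_quotient` with one additional real eigenvector outside `V`. -/
theorem odd_finrank_quotient {X : Type*} [NormedAddCommGroup X] [NormedSpace ℝ X] {ι : Type*}
    (E : X →L[ℝ] X) (V : Submodule ℝ X)
    [FiniteDimensional ℝ (X ⧸ V)] (hV : IsClosed (V : Set X)) (hE : ∀ η ∈ V, E η ∈ V)
    (ψ : ι → ℂ →ₗ[ℝ] X) (a : ι → ℂ) (ha : ∀ k, (a k).im ≠ 0)
    (hψ : ∀ k c, E (ψ k c) = ψ k (a k * c)) {e : X} {x : ℝ} (he : e ∉ V) (hEe : E e = x • e)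
    (hd : ∀ ℓ : X →L[ℝ] ℝ, (∀ η ∈ V, ℓ η = 0) → ℓ e = 0 → (∀ k c, ℓ (ψ k c) = 0) → ℓ = 0) :
    Odd (Module.finrank ℝ (X ⧸ V)) := by
  -- Adding `e` to `V` lowers the codimension by one and reduces to the even case.
  set V' : Submodule ℝ X := V ⊔ Submodule.span ℝ {e} with hV'
  have hle : V ≤ V' := le_sup_left
  have heV' : e ∈ V' := le_sup_right (a := V) (Submodule.mem_span_singleton_self e)
  let Φ := Submodule.quotientQuotientEquivQuotient V V' hle
  have hfd : FiniteDimensional ℝ (X ⧸ V') := Φ.finiteDimensional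
  have hEV' : ∀ η ∈ V', E η ∈ V' := by
    intro η hη
    obtain ⟨y, hy, z, hz, rfl⟩ := Submodule.mem_sup.1 hη
    obtain ⟨c, rfl⟩ := Submodule.mem_span_singleton.1 hz
    rw [map_add, map_smul, hEe]
    exact V'.add_mem (hle (hE y hy)) (V'.smul_mem _ (V'.smul_mem _ heV'))
  have heven := even_finrank_quotient E V' (Submodule.isClosed_sup_finiteDimensional _ _ hV) hEV'
    ψ a ha hψ fun ℓ h1 h2 => hd ℓ (fun η hη => h1 η (hle hη)) (h1 e heV') h2
  have hmap : V'.map V.mkQ = Submodule.span ℝ {V.mkQ e} := by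
    rw [hV', Submodule.map_sup, Submodule.map_span, Set.image_singleton]
    simp
  have hne : V.mkQ e ≠ 0 := fun h => he ((Submodule.Quotient.mk_eq_zero V).1 h)
  have h1 := Submodule.finrank_quotient_add_finrank (V'.map V.mkQ)
  rw [Φ.finrank_eq, hmap, finrank_span_singleton hne] at h1
  rw [← h1]
  exact heven.add_one

/-- The parity argument needs one operator for all modes. Each `exp (-μ * t)` is real only if `t *
μ.im` is a multiple of `π`, so the bad times form a countable set. -/
theorem exists_time_exp_im_ne_zero {ι : Type*} [Countable ι] {μ : ι → ℂ}
    (hμ : ∀ i, (μ i).im ≠ 0) : ∃ t : ℝ, 0 < t ∧ ∀ i, (Complex.exp (-μ i * t)).im ≠ 0 := by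
  have hc : (⋃ i, ⋃ k : ℤ, {(k : ℝ) * Real.pi / (μ i).im}).Countable :=
    Set.countable_iUnion fun i => Set.countable_iUnion fun k => Set.countable_singleton _
  obtain ⟨t, ht, ht0⟩ := (hc.dense_compl ℝ).exists_mem_open isOpen_Ioi
    (⟨1, Set.mem_Ioi.2 one_pos⟩ : (Set.Ioi (0 : ℝ)).Nonempty)
  refine ⟨t, ht0, fun i h => ht ?_⟩
  rw [Complex.exp_im] at h
  have h1 : (-μ i * t).im = -((μ i).im * t) := by simp
  rw [h1, Real.sin_neg] at h
  have h2 : Real.sin ((μ i).im * t) = 0 := by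
    simpa [(Real.exp_pos _).ne'] using h
  obtain ⟨k, hk⟩ := Real.sin_eq_zero_iff.1 h2
  refine Set.mem_iUnion.2 ⟨i, Set.mem_iUnion.2 ⟨k, ?_⟩⟩
  rw [Set.mem_singleton_iff, eq_div_iff (hμ i), hk, mul_comm]

/-- The quadratic equation for the decay rates has no real root. -/
def NoRealRate (ε : ℝ) (ν : ℂ) : Prop := ∀ x : ℝ, (ε * (x : ℂ) ^ 2 - x + ν : ℂ) ≠ 0

theorem NoRealRate.im_ne_zero {ε : ℝ} {ν μ : ℂ} (h : NoRealRate ε ν)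
    (hμ : ε * μ ^ 2 - μ + ν = 0) : μ.im ≠ 0 := by
  intro h0
  have h1 : μ = (μ.re : ℂ) := Complex.ext rfl (by simpa using h0)
  rw [h1] at hμ
  exact h _ hμ

/-- A double root would equal `1 / (2 * ε)`, which is real. -/
theorem NoRealRate.exists_rates {ε : ℝ} (hε : 0 < ε) {ν : ℂ} (h : NoRealRate ε ν) :
    ∃ μ₁ μ₂ : ℂ, ε * μ₁ ^ 2 - μ₁ + ν = 0 ∧ ε * μ₂ ^ 2 - μ₂ + ν = 0 ∧ μ₁ ≠ μ₂ := by
  obtain ⟨w, hw⟩ := IsAlgClosed.exists_pow_nat_eq (1 - 4 * (ε : ℂ) * ν) (n := 2) two_pos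
  have hε' : (ε : ℂ) ≠ 0 := by exact_mod_cast hε.ne'
  have h1 : (ε : ℂ) * ((1 + w) / (2 * ε)) ^ 2 - (1 + w) / (2 * ε) + ν = 0 := by
    field_simp
    linear_combination hw
  have h2 : (ε : ℂ) * ((1 - w) / (2 * ε)) ^ 2 - (1 - w) / (2 * ε) + ν = 0 := by
    field_simp
    linear_combination hw
  refine ⟨_, _, h1, h2, fun heq => h.im_ne_zero h1 ?_⟩
  have h3 : w = 0 := by
    field_simp at heq
    linear_combination heq / 2
  rw [h3, add_zero]
  have : (1 : ℂ) / (2 * ε) = ((1 / (2 * ε) : ℝ) : ℂ) := by push_cast; rfl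
  rw [this, Complex.ofReal_im]

variable {H : Type*} [NormedAddCommGroup H] [InnerProductSpace ℝ H] [CompleteSpace H]

namespace PosOp

variable (A : PosOp H)

theorem basis_mem_H1sub (n : ℕ) : A.basis n ∈ A.H1sub := by
  change Memℓp (fun k => √(A.eigenvalue k) * A.coeff k (A.basis n)) 2
  have h : (fun k => √(A.eigenvalue k) * A.coeff k (A.basis n)) =
      (lp.single 2 n √(A.eigenvalue n) : Seq2) := by
    funext k
    rw [A.coeff_basis, lp.single_apply]
    rcases eq_or_ne k n with rfl | hk
    · simp
    · simp [hk]
  rw [h]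
  exact lp.memℓp _

/-- The eigenvectors as elements of `H¹`. -/
def basisH1 (n : ℕ) : A.H1 := ⟨A.basis n, A.basis_mem_H1sub n⟩

@[simp] theorem incl_basisH1 (n : ℕ) : A.incl (A.basisH1 n) = A.basis n := rfl

/-- The isometry `A^{1/2}` from `H¹` to `ℓ²`. -/
def sqrtIsometry : A.H1 →ₗᵢ[ℝ] Seq2 := ⟨A.sqrtCoord, fun _ => rfl⟩

theorem hasSum_basisH1 (u : A.H1) :
    HasSum (fun n => A.coeff n (A.incl u) • A.basisH1 n) u := by
  rw [← A.sqrtIsometry.isometry.isEmbedding.isInducing.hasSum_iff]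
  have h := lp.hasSum_single (p := 2) (by norm_num) (A.sqrtIsometry u)
  convert h using 1
  funext n
  apply Subtype.ext
  funext k
  have h1 : (A.sqrtIsometry (A.coeff n (A.incl u) • A.basisH1 n) : Seq2) k =
      √(A.eigenvalue k) * A.coeff k (A.incl (A.coeff n (A.incl u) • A.basisH1 n)) := rfl
  have h2 : (A.sqrtIsometry u : Seq2) n = √(A.eigenvalue n) * A.coeff n (A.incl u) := rfl
  rw [Function.comp_apply, h1, h2, map_smul, A.coeff_smul, incl_basisH1, A.coeff_basis,
    lp.single_apply]
  rcases eq_or_ne k n with rfl | hk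
  · simp
  · simp [hk]

theorem H1_functional_eq_zero {ℓ : A.H1 →L[ℝ] ℝ} (h : ∀ n, ℓ (A.basisH1 n) = 0) : ℓ = 0 := by
  ext u
  have h1 := ℓ.hasSum (A.hasSum_basisH1 u)
  simp only [map_smul, h, smul_zero] at h1
  exact h1.unique hasSum_zero

variable {ε : ℝ}

/-- The inclusion of the positions in the energy space. -/
def restL (ε : ℝ) : A.H1 →L[ℝ] A.Energy ε :=
  (⟨{ toFun := fun p => A.rest ε p
      map_add' := fun _ _ => A.energy_ext rfl (add_zero (0 : H)).symm
      map_smul' := fun c _ => A.energy_ext rfl (smul_zero c).symm },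
    fun p => A.norm_rest p⟩ : A.H1 →ₗᵢ[ℝ] A.Energy ε).toContinuousLinearMap

theorem restL_apply (p : A.H1) : A.restL ε p = A.rest ε p := rfl

/-- The inclusion of the velocities in the energy space, as a linear map. -/
def pushLinear (ε : ℝ) : H →ₗ[ℝ] A.Energy ε where
  toFun v := ((0 : A.H1), v)
  map_add' _ _ := A.energy_ext (add_zero (0 : H)).symm rfl
  map_smul' c _ := A.energy_ext (smul_zero c).symm rfl

theorem norm_pushLinear_le (hε : 0 ≤ ε) (v : H) :
    ‖A.pushLinear ε v‖ ≤ √(ε + (A.eigenvalue 0)⁻¹) * ‖v‖ := by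
  have h0 := A.eigenvalue_pos 0
  refine (abs_le_of_sq_le_sq' ?_ (by positivity)).2
  have h1 : A.pos ε (A.pushLinear ε v) = 0 := rfl
  have h2 : A.vel ε (A.pushLinear ε v) = v := rfl
  rw [mul_pow, Real.sq_sqrt (by positivity), A.energy_norm_sq ε hε, h1, h2, add_mul]
  have h3 : ∀ n, (A.eigenvalue n)⁻¹ * A.coeff n v ^ 2 ≤
      (A.eigenvalue 0)⁻¹ * A.coeff n v ^ 2 := fun n =>
    mul_le_mul_of_nonneg_right (inv_anti₀ h0 (A.eigenvalue_mono (Nat.zero_le n))) (sq_nonneg _)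
  have h4 := (A.summable_coeff_sq v).mul_left (A.eigenvalue 0)⁻¹
  have h5 := (Summable.of_nonneg_of_le
    (fun n => mul_nonneg (inv_nonneg.2 (A.eigenvalue_pos n).le) (sq_nonneg _)) h3 h4).tsum_le_tsum
    h3 h4
  rw [tsum_mul_left, ← A.norm_sq_eq_tsum] at h5
  simpa using h5

theorem energy_functional_eq_zero (hε : 0 ≤ ε) {ℓ : A.Energy ε →L[ℝ] ℝ}
    (h : ∀ n, ℓ (A.rest ε (A.basisH1 n)) = 0) (h' : ∀ n, ℓ (A.pushLinear ε (A.basis n)) = 0) :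
    ℓ = 0 := by
  have h1 : ℓ.comp (A.restL ε) = 0 := A.H1_functional_eq_zero h
  let P : H →L[ℝ] A.Energy ε := (A.pushLinear ε).mkContinuous _ (A.norm_pushLinear_le hε)
  have h2 : ∀ v, ℓ (P v) = 0 := by
    intro v
    have h3 := (ℓ.comp P).hasSum (A.basis.hasSum_repr v)
    have h4 : ∀ n, ℓ (P (A.basis n)) = 0 := h'
    simp only [map_smul, ContinuousLinearMap.comp_apply, h4, smul_zero] at h3
    exact h3.unique hasSum_zero
  ext ξ
  have h3 : ξ = A.restL ε ξ.1 + P ξ.2 := A.energy_ext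
    (by rw [map_add]; exact (add_zero (A.incl ξ.1)).symm) (zero_add (ξ.2 : H)).symm
  rw [h3, map_add, h2, add_zero]
  exact congrArg (fun f : A.H1 →L[ℝ] ℝ => f ξ.1) h1

theorem abs_coeff_pos_le (n : ℕ) (ξ : A.Energy ε) :
    |A.coeff n (A.pos ε ξ)| ≤ (√(A.eigenvalue 0))⁻¹ * ‖ξ‖ := by
  refine (A.abs_coeff_le n _).trans ((A.norm_incl_le ξ.1).trans ?_)
  refine mul_le_mul_of_nonneg_left ?_ (by positivity)
  exact WithLp.norm_fst_le _ (A.energyCoord ε ξ)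

/-- The eigenvalues tend to infinity. -/
theorem exists_le_eigenvalue (B : ℝ) : ∃ n, B ≤ A.eigenvalue n := by
  by_contra! hB
  obtain ⟨K, hK, -, hKA⟩ := A.compact_inverse
  have hKe : ∀ n, K (A.basis n) = (A.eigenvalue n)⁻¹ • A.basis n := by
    intro n
    obtain ⟨hd, hAn⟩ := A.eigen n
    have h1 := hKA ⟨A.basis n, hd⟩
    rw [hAn, map_smul] at h1
    have h2 : A.eigenvalue n • K (A.basis n) = A.basis n := h1
    conv_rhs => rw [← h2]
    rw [inv_smul_smul₀ (A.eigenvalue_pos n).ne']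
  obtain ⟨C, hC, hsub⟩ := IsCompactOperator.image_closedBall_subset_compact (f := K.toLinearMap) hK 1
  have hmem : ∀ n, K (A.basis n) ∈ C := fun n =>
    hsub ⟨_, by simp [A.basis.orthonormal.1 n], rfl⟩
  obtain ⟨y, -, φ, hφ, hlim⟩ := hC.tendsto_subseq hmem
  have hB0 : 0 < B := (A.eigenvalue_pos 0).trans (hB 0)
  obtain ⟨M, hM⟩ := Metric.cauchySeq_iff'.1 hlim.cauchySeq B⁻¹ (inv_pos.2 hB0)
  have h1 := hM (M + 1) (Nat.le_succ M)
  rw [dist_eq_norm] at h1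
  -- If `B` bounded the eigenvalues, the images of distinct `e_n` under the compact inverse would be
  -- at distance at least `B⁻¹`.
  have h2 := A.abs_coeff_le (φ M) ((fun n => K (A.basis n)) (φ (M + 1)) - K (A.basis (φ M)))
  have h3 : φ M ≠ φ (M + 1) := (hφ (Nat.lt_succ_self M)).ne
  simp only [hKe, A.coeff_sub, A.coeff_smul, A.coeff_basis, if_neg h3, if_true, mul_zero,
    mul_one, zero_sub, abs_neg] at h2
  rw [abs_of_pos (inv_pos.2 (A.eigenvalue_pos _))] at h2
  have h4 : B⁻¹ ≤ (A.eigenvalue (φ M))⁻¹ := inv_anti₀ (A.eigenvalue_pos _) (hB _).le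
  simp only [Function.comp_apply, hKe] at h1
  linarith

/-- The real parts of the multiples of the complex vector `e_n + ζ e_m`. -/
def planeMode (n m : ℕ) (ζ : ℂ) : ℂ →ₗ[ℝ] A.H1 where
  toFun c := c.re • A.basisH1 n + (c * ζ).re • A.basisH1 m
  map_add' c d := by simp only [add_mul, Complex.add_re, add_smul]; abel
  map_smul' x c := by
    simp only [smul_mul_assoc, Complex.smul_re, smul_eq_mul, mul_smul, smul_add,
      RingHom.id_apply]

theorem planeMode_apply (n m : ℕ) (ζ c : ℂ) :
    A.planeMode n m ζ c = c.re • A.basisH1 n + (c * ζ).re • A.basisH1 m := rfl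

theorem coeff_planeMode (n m : ℕ) (ζ c : ℂ) (j : ℕ) :
    A.coeff j (A.incl (A.planeMode n m ζ c)) =
      c.re * (if j = n then 1 else 0) + (c * ζ).re * (if j = m then 1 else 0) := by
  rw [planeMode_apply, map_add, map_smul, map_smul, A.coeff_add, A.coeff_smul, A.coeff_smul,
    incl_basisH1, incl_basisH1, A.coeff_basis, A.coeff_basis]

/-- The vector `e_n` lies in a mode of `A - K` all of whose decay rates are nonreal. -/
def IsOscillating (ε : ℝ) (K : H →L[ℝ] H) (n : ℕ) : Prop :=
  ∃ (ν : ℂ) (Z : ℂ →ₗ[ℝ] A.H1), A.IsMode K ν Z ∧ NoRealRate ε ν ∧ ∃ c, Z c = A.basisH1 n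

section WeightedPerm

variable {A} {σ : ℕ → ℕ} {s : ℕ → ℝ} {K : H →L[ℝ] H}

/-- With `ζ = 0` and equal indices the plane collapses to the real line of `e_n`, and `ν` is real.
-/
theorem isMode_single (hK : ∀ n u, A.coeff n (K u) = s n * A.coeff (σ n) u)
    (hσ : Function.Injective σ) {n : ℕ} (hn : σ n = n) :
    A.IsMode K ((A.eigenvalue n - s n : ℝ) : ℂ) (A.planeMode n n 0) := by
  intro c j
  rw [hK, coeff_planeMode, coeff_planeMode, coeff_planeMode]
  rcases eq_or_ne j n with rfl | hj
  · simp [hn]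
    ring
  · have : σ j ≠ n := fun h => hj (hσ (h.trans hn.symm))
    simp [hj, this]

/-- On the plane of `e_n` and `e_m` the operator `A - K` has the matrix with rows `(λ_n, a)` and
`(-a, λ_m)`. The quadratic equation says that `e_n + ζ e_m` is an eigenvector. -/
theorem isMode_pair (hK : ∀ n u, A.coeff n (K u) = s n * A.coeff (σ n) u)
    (hσ : Function.Injective σ) {n m : ℕ} {a : ℝ} {ζ : ℂ} (hnm : n ≠ m) (hn : σ n = m)
    (hm : σ m = n) (hsn : s n = -a) (hsm : s m = a)
    (hζ : a * ζ ^ 2 - (A.eigenvalue m - A.eigenvalue n : ℝ) * ζ + a = 0) :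
    A.IsMode K (A.eigenvalue n + a * ζ) (A.planeMode n m ζ) := by
  intro c j
  rw [hK, coeff_planeMode, coeff_planeMode, coeff_planeMode]
  rcases eq_or_ne j n with rfl | hj
  · simp [hn, hsn, hnm, hnm.symm]
    ring
  rcases eq_or_ne j m with rfl | hj'
  · have h1 : (A.eigenvalue n + a * ζ) * c * ζ = A.eigenvalue j * (c * ζ) - a * c := by
      push_cast at hζ
      linear_combination c * hζ
    rw [h1]
    simp [hm, hsm, hj, hnm]
  · have h1 : σ j ≠ n := fun h => hj' (hσ (h.trans hm.symm))
    have h2 : σ j ≠ m := fun h => hj (hσ (h.trans hn.symm))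
    simp [hj, hj', h1, h2]

/-- The discriminant `1 - 4 * ε * (λ_n + a)` is negative; the last hypothesis forces `ε > 0`. -/
theorem isOscillating_single (hK : ∀ n u, A.coeff n (K u) = s n * A.coeff (σ n) u)
    (hσ : Function.Injective σ) {n : ℕ} {a ε : ℝ} (ha : 0 < a) (hε : 0 ≤ ε) (hn : σ n = n)
    (hsn : s n = -a) (h : 1 ≤ 4 * ε * A.eigenvalue n) : A.IsOscillating ε K n := by
  refine ⟨_, _, isMode_single hK hσ hn, fun x hx => ?_, 1, by simp [planeMode_apply]⟩
  have h1 : ε * x ^ 2 - x + (A.eigenvalue n - s n) = 0 := by exact_mod_cast hx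
  rw [hsn] at h1
  have hε' : 0 < ε := hε.lt_of_ne (by rintro rfl; norm_num at h)
  nlinarith [sq_nonneg (2 * ε * x - 1), mul_pos hε' ha]

/-- The discriminant `g ^ 2 - 4 * a ^ 2` is negative, hence `ν` is nonreal, and then no real number
can be a decay rate, whatever `ε` is. -/
theorem isOscillating_pair (hK : ∀ n u, A.coeff n (K u) = s n * A.coeff (σ n) u)
    (hσ : Function.Injective σ) {n m : ℕ} {a ε : ℝ} (ha : 0 < a) (hnm : n ≠ m)
    (hn : σ n = m) (hm : σ m = n) (hsn : s n = -a) (hsm : s m = a)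
    (hle : A.eigenvalue n ≤ A.eigenvalue m) (hgap : A.eigenvalue m - A.eigenvalue n < 2 * a) :
    A.IsOscillating ε K n ∧ A.IsOscillating ε K m := by
  set g := A.eigenvalue m - A.eigenvalue n with hg
  have hg0 : 0 ≤ g := sub_nonneg.2 hle
  set d := √(4 * a ^ 2 - g ^ 2) with hd
  have hd2 : d ^ 2 = 4 * a ^ 2 - g ^ 2 := Real.sq_sqrt (by nlinarith)
  have hd0 : 0 < d := Real.sqrt_pos.2 (by nlinarith)
  set ζ : ℂ := ⟨g / (2 * a), d / (2 * a)⟩ with hζ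
  have hζeq : a * ζ ^ 2 - (g : ℝ) * ζ + a = 0 := by
    apply Complex.ext
    · simp [hζ, pow_two]
      field_simp
      linear_combination -hd2
    · simp [hζ, pow_two]
      field_simp
      ring
  have hmode := isMode_pair hK hσ hnm hn hm hsn hsm hζeq
  have hrate : NoRealRate ε (A.eigenvalue n + a * ζ) := by
    intro x hx
    have h1 := congrArg Complex.im hx
    have h2 : a * (d / (2 * a)) = 0 := by simpa [hζ, pow_two] using h1
    have : 0 < a * (d / (2 * a)) := by positivity
    exact this.ne' h2
  -- The two values of `c` solve `c.re = 1`, `(c * ζ).re = 0` and `c.re = 0`, `(c * ζ).re = 1`.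
  refine ⟨⟨_, _, hmode, hrate, ⟨1, g / d⟩, ?_⟩, ⟨_, _, hmode, hrate, ⟨0, -(2 * a / d)⟩, ?_⟩⟩
  · rw [planeMode_apply]
    have : ((⟨1, g / d⟩ : ℂ) * ζ).re = 0 := by
      simp [hζ]
      field_simp
      ring
    rw [this]
    simp
  · rw [planeMode_apply]
    have : ((⟨0, -(2 * a / d)⟩ : ℂ) * ζ).re = 1 := by
      simp [hζ]
      field_simp
    rw [this]
    simp

end WeightedPerm

end PosOp

end

/-! ### Parity of the dimension at the two equilibria. -/

section

variable {H : Type*} [NormedAddCommGroup H] [InnerProductSpace ℝ H] [CompleteSpace H]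

namespace PosOp

variable (A : PosOp H)

theorem not_mem_of_growth {X : Type*} [NormedAddCommGroup X] [NormedSpace ℝ X]
    {E : ℝ → X →L[ℝ] X} {V : Submodule ℝ X} {C ρ x : ℝ} {e : X} (hρ : 0 < ρ)
    (hV : ∀ t, 0 ≤ t → ∀ η ∈ V, ‖E t η‖ ≤ C * Real.exp (-ρ * t) * ‖η‖) (hx : x ≤ 0)
    (he : e ≠ 0) (hE : ∀ t, 0 ≤ t → E t e = Real.exp (-x * t) • e) : e ∉ V := by
  intro heV
  have hlim := tendsto_exp_mul_atTop_zero (r := -ρ) (by linarith) (C * ‖e‖)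
  have h1 : ‖e‖ ≤ 0 := ge_of_tendsto hlim (by
    filter_upwards [eventually_ge_atTop 0] with t ht
    have h2 := hV t ht e heV
    rw [hE t ht, norm_smul, Real.norm_of_nonneg (Real.exp_nonneg _)] at h2
    have h3 : 1 ≤ Real.exp (-x * t) := Real.one_le_exp (mul_nonneg (by linarith) ht)
    have h4 := mul_le_mul_of_nonneg_right h3 (norm_nonneg e)
    linarith)
  exact he (norm_le_zero_iff.1 h1)

section Hyperbolic

variable {ε : ℝ}

theorem phaseMode_eq (Z : ℂ →ₗ[ℝ] A.H1) (μ c : ℂ) :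
    A.phaseMode ε Z μ c = A.rest ε (Z c) - A.pushLinear ε (A.incl (Z (μ * c))) := by
  refine A.energy_ext ?_ ?_
  · rw [map_sub]
    exact (sub_zero (A.incl (Z c))).symm
  · rw [map_sub]
    have h1 : A.vel ε (A.phaseMode ε Z μ c) = A.incl (Z (-μ * c)) := rfl
    rw [h1, neg_mul, map_neg, map_neg]
    exact (zero_sub (A.incl (Z (μ * c)))).symm

/-- The phase vectors of rates `μ₁` and `μ₂` share their position and differ by a pure velocity. As
`μ₁ - μ₂` is invertible, both rates together generate positions and velocities separately. -/
theorem functional_phaseMode {ℓ : A.Energy ε →L[ℝ] ℝ} {Z : ℂ →ₗ[ℝ] A.H1} {μ₁ μ₂ : ℂ}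
    (hμ : μ₁ ≠ μ₂) (h₁ : ∀ c, ℓ (A.phaseMode ε Z μ₁ c) = 0)
    (h₂ : ∀ c, ℓ (A.phaseMode ε Z μ₂ c) = 0) (c : ℂ) :
    ℓ (A.rest ε (Z c)) = 0 ∧ ℓ (A.pushLinear ε (A.incl (Z c))) = 0 := by
  have hq : ∀ c, ℓ (A.pushLinear ε (A.incl (Z c))) = 0 := by
    intro c
    have h1 := h₁ ((μ₁ - μ₂)⁻¹ * c)
    have h2 := h₂ ((μ₁ - μ₂)⁻¹ * c)
    rw [phaseMode_eq, map_sub] at h1 h2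
    have h3 : c = μ₁ * ((μ₁ - μ₂)⁻¹ * c) - μ₂ * ((μ₁ - μ₂)⁻¹ * c) := by
      field_simp [sub_ne_zero.2 hμ]
    rw [h3]
    simp only [map_sub]
    linarith
  refine ⟨?_, hq c⟩
  have h1 := h₁ c
  rwa [phaseMode_eq, map_sub, hq, sub_zero] at h1

variable {L : ℝ} {F : H → H} {S : ℝ → A.Energy ε → A.Energy ε} {p : A.H1} {K : H →L[ℝ] H}

/-- Each mode enters twice, once for each of its two nonreal rates; hence the index set `ℕ ⊕ ℕ`. -/
theorem hyperbolic_oscillating_family (hε : 0 < ε) (hF : ∀ u v, ‖F u - F v‖ ≤ L * ‖u - v‖)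
    (hS : A.IsHyperbolicSemigroup ε F S) (hp : A.IsAffineEquilibrium F (A.incl p) K)
    (hd : ∀ t, 0 ≤ t → DifferentiableAt ℝ (S t) (A.rest ε p)) {f : ℕ → ℕ}
    (hf : ∀ k, A.IsOscillating ε K (f k)) :
    ∃ (t : ℝ) (ψ : ℕ ⊕ ℕ → ℂ →ₗ[ℝ] A.Energy ε) (a : ℕ ⊕ ℕ → ℂ), 0 ≤ t ∧ (∀ k, (a k).im ≠ 0) ∧
      (∀ k c, fderiv ℝ (S t) (A.rest ε p) (ψ k c) = ψ k (a k * c)) ∧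
      ∀ ℓ : A.Energy ε →L[ℝ] ℝ, (∀ k c, ℓ (ψ k c) = 0) → ∀ k,
        ℓ (A.rest ε (A.basisH1 (f k))) = 0 ∧ ℓ (A.pushLinear ε (A.basis (f k))) = 0 := by
  choose ν Z hZ hν c hc using hf
  choose μ₁ μ₂ h₁ h₂ hne using fun k => (hν k).exists_rates hε
  obtain ⟨t, ht, hexp⟩ := exists_time_exp_im_ne_zero (μ := Sum.elim μ₁ μ₂) (by
    rintro (k | k)
    · exact (hν k).im_ne_zero (h₁ k)
    · exact (hν k).im_ne_zero (h₂ k))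
  refine ⟨t, Sum.elim (fun k => A.phaseMode ε (Z k) (μ₁ k)) fun k => A.phaseMode ε (Z k) (μ₂ k),
    fun i => Complex.exp (-Sum.elim μ₁ μ₂ i * t), ht.le, hexp, ?_, fun ℓ hℓ k => ?_⟩
  · rintro (k | k) c
    · exact A.hyperbolic_fderiv hε hF hS hp (hZ k) (h₁ k) ht.le (hd t ht.le) c
    · exact A.hyperbolic_fderiv hε hF hS hp (hZ k) (h₂ k) ht.le (hd t ht.le) c
  · have := A.functional_phaseMode (hne k) (hℓ (Sum.inl k)) (hℓ (Sum.inr k)) (c k)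
    rwa [hc] at this

theorem hyperbolic_even (hε : 0 < ε) (hF : ∀ u v, ‖F u - F v‖ ≤ L * ‖u - v‖)
    (hS : A.IsHyperbolicSemigroup ε F S) (hp : A.IsAffineEquilibrium F (A.incl p) K)
    (hosc : ∀ n, A.IsOscillating ε K n) {N : ℕ} {M : Set (A.Energy ε)} (hM : IsNHIM A N S M) :
    Even N := by
  have hfix : ∀ t, 0 ≤ t → S t (A.rest ε p) = A.rest ε p := fun t ht =>
    A.hyperbolic_fixed hε hF hS hp ht
  have hmem := hM.1.mem_of_fixed hfix
  obtain ⟨V, -, -, -, hV, hfd, hN, -, -, hinv, -, -⟩ := hM.2.normalFibre hmem hfix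
  obtain ⟨t, ψ, a, ht, ha, hψ, hℓ⟩ := A.hyperbolic_oscillating_family hε hF hS hp
    (fun t ht => hM.2.differentiable t ht _ hmem) hosc
  rw [← hN]
  exact even_finrank_quotient _ V hV (hinv t ht) ψ a ha hψ fun ℓ _ h =>
    A.energy_functional_eq_zero hε.le (fun n => (hℓ ℓ h n).1) fun n => (hℓ ℓ h n).2

theorem hyperbolic_fderiv_real (hε : 0 < ε) (hF : ∀ u v, ‖F u - F v‖ ≤ L * ‖u - v‖)
    (hS : A.IsHyperbolicSemigroup ε F S) (hp : A.IsAffineEquilibrium F (A.incl p) K)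
    {ν : ℝ} {Z : ℂ →ₗ[ℝ] A.H1} (hZ : A.IsMode K ν Z) {x : ℝ} (hx : ε * x ^ 2 - x + ν = 0)
    {t : ℝ} (ht : 0 ≤ t) (hd : DifferentiableAt ℝ (S t) (A.rest ε p)) (c : ℂ) :
    fderiv ℝ (S t) (A.rest ε p) (A.phaseMode ε Z x c) =
      Real.exp (-x * t) • A.phaseMode ε Z x c := by
  rw [A.hyperbolic_fderiv hε hF hS hp hZ (μ := x) (by exact_mod_cast congrArg Complex.ofReal hx) ht hd,
    ← map_smul, Complex.real_smul]
  push_cast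
  rfl

/-- If infinitely many modes decay at the rate `1 / (2ε)`, then no closed subspace of finite
codimension has a larger uniform decay rate. -/
theorem hyperbolic_decay_rate_le (hε : 0 < ε) (hF : ∀ u v, ‖F u - F v‖ ≤ L * ‖u - v‖)
    (hS : A.IsHyperbolicSemigroup ε F S) (hp : A.IsAffineEquilibrium F (A.incl p) K)
    (hd : ∀ t, 0 ≤ t → DifferentiableAt ℝ (S t) (A.rest ε p)) {m : ℕ} {ν : ℕ → ℝ}
    (hmode : ∀ n, m ≤ n → A.IsMode K (ν n) (A.planeMode n n 0))
    (hν : ∀ n, m ≤ n → 1 < 4 * ε * ν n) {V : Submodule ℝ (A.Energy ε)} {C ρ : ℝ}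
    [FiniteDimensional ℝ (A.Energy ε ⧸ V)]
    (hV : ∀ t, 0 ≤ t → ∀ η ∈ V,
      ‖fderiv ℝ (S t) (A.rest ε p) η‖ ≤ C * Real.exp (-ρ * t) * ‖η‖) : ρ ≤ 1 / (2 * ε) := by
  by_contra! hρ
  set ω : ℕ → ℝ := fun n => √(4 * ε * ν n - 1) with hω
  have hω0 : ∀ n, m ≤ n → 0 < ω n := fun n hn => Real.sqrt_pos.2 (by linarith [hν n hn])
  have hω2 : ∀ n, m ≤ n → ω n ^ 2 = 4 * ε * ν n - 1 := fun n hn =>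
    Real.sq_sqrt (by linarith [hν n hn])
  -- An underdamped mode has rates with real part `1 / (2 * ε)`, independent of `n`.
  set μ : ℕ → ℂ := fun n => ⟨1 / (2 * ε), ω n / (2 * ε)⟩ with hμ
  have hroot : ∀ n, m ≤ n → ε * μ n ^ 2 - μ n + (ν n : ℂ) = 0 := by
    intro n hn
    have h1 := hω2 n hn
    apply Complex.ext
    · simp [hμ, pow_two]
      field_simp
      linear_combination -h1
    · simp [hμ, pow_two]
      field_simp
      ring
  -- This `c` has real part `1` and makes `μ n * c` imaginary, so the initial velocity vanishes.
  have hrest : ∀ n, m ≤ n → A.rest ε (A.basisH1 n) =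
      A.phaseMode ε (A.planeMode n n 0) (μ n) ⟨1, (ω n)⁻¹⟩ := by
    intro n hn
    have h0 := (hω0 n hn).ne'
    have h1 : (μ n * ⟨1, (ω n)⁻¹⟩).re = 0 := by
      simp [hμ]
      field_simp
      ring
    rw [phaseMode_eq]
    simp only [planeMode_apply, h1]
    simp
  have hE : ∀ t, 0 ≤ t → ∀ n, m ≤ n → ∀ j,
      A.coeff j (A.pos ε (fderiv ℝ (S t) (A.rest ε p) (A.rest ε (A.basisH1 n)))) =
        (Complex.exp (-μ n * t) * ⟨1, (ω n)⁻¹⟩).re * (if j = n then 1 else 0) := by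
    intro t ht n hn j
    rw [hrest n hn, A.hyperbolic_fderiv hε hF hS hp (hmode n hn) (hroot n hn) ht (hd t ht)]
    refine (A.coeff_planeMode n n 0 _ j).trans ?_
    simp
  -- Infinitely many vectors are dependent modulo a subspace of finite codimension, so some
  -- nontrivial combination of them lies in `V`.
  have hdep : ¬ LinearIndependent ℝ fun j : ℕ => V.mkQ (A.rest ε (A.basisH1 (m + j))) := by
    intro h
    have := h.finite_of_isNoetherian
    exact not_finite ℕ
  obtain ⟨s, g, hsum, i, hi, hgi⟩ := not_linearIndependent_iff.1 hdep
  set w : A.Energy ε := ∑ j ∈ s, g j • A.rest ε (A.basisH1 (m + j)) with hw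
  have hwV : w ∈ V := by
    rw [← Submodule.Quotient.mk_eq_zero V, ← Submodule.mkQ_apply, hw, map_sum]
    simpa only [map_smul] using hsum
  have hcoeff : ∀ t, 0 ≤ t → A.coeff (m + i) (A.pos ε (fderiv ℝ (S t) (A.rest ε p) w)) =
      g i * (Complex.exp (-μ (m + i) * t) * ⟨1, (ω (m + i))⁻¹⟩).re := by
    intro t ht
    rw [hw, map_sum, map_sum, ← A.coeffL_apply, map_sum, Finset.sum_eq_single i]
    · rw [map_smul, map_smul, map_smul, A.coeffL_apply, hE t ht _ (Nat.le_add_right m i)]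
      simp
    · intro j _ hj
      rw [map_smul, map_smul, map_smul, A.coeffL_apply, hE t ht _ (Nat.le_add_right m j)]
      simp [hj.symm]
    · exact fun h => absurd hi h
  have hωi := hω0 (m + i) (Nat.le_add_right m i)
  -- At these times the mode `m + i` has completed whole periods, and its coefficient is exactly `g
  -- i * exp (-τ / (2 * ε))`. A rate above `1 / (2 * ε)` would force `g i = 0`.
  set τ : ℕ → ℝ := fun k => k * (2 * Real.pi) * (2 * ε) / ω (m + i) with hτ
  have hτ0 : ∀ k, 0 ≤ τ k := fun k => by positivity
  have hτlim : Tendsto τ atTop atTop := by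
    have h1 : τ = fun k : ℕ => (k : ℝ) * (2 * Real.pi * (2 * ε) / ω (m + i)) := by
      funext k; simp only [hτ]; ring
    rw [h1]
    exact tendsto_natCast_atTop_atTop.atTop_mul_const (by positivity)
  have hre : ∀ k, (Complex.exp (-μ (m + i) * τ k) * ⟨1, (ω (m + i))⁻¹⟩).re =
      Real.exp (-(1 / (2 * ε)) * τ k) := by
    intro k
    have h1 : (-μ (m + i) * τ k).im = -(k * (2 * Real.pi)) := by
      simp [hμ, hτ]
      field_simp
    have h2 : (-μ (m + i) * τ k).re = -(1 / (2 * ε)) * τ k := by simp [hμ]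
    rw [Complex.mul_re, Complex.exp_re, Complex.exp_im, h1, h2, Real.cos_neg, Real.sin_neg,
      Real.cos_nat_mul_two_pi]
    have h3 : Real.sin (k * (2 * Real.pi)) = 0 := by
      have := Real.sin_nat_mul_pi (2 * k)
      push_cast at this
      rw [← this]; ring_nf
    rw [h3]
    simp
  have hbound : ∀ k, |g i| ≤
      (√(A.eigenvalue 0))⁻¹ * C * ‖w‖ * Real.exp (-(ρ - 1 / (2 * ε)) * τ k) := by
    intro k
    have h1 := (A.abs_coeff_pos_le (m + i) (fderiv ℝ (S (τ k)) (A.rest ε p) w)).trans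
      (mul_le_mul_of_nonneg_left (hV _ (hτ0 k) w hwV) (by positivity))
    rw [hcoeff _ (hτ0 k), hre, abs_mul, abs_of_pos (Real.exp_pos _)] at h1
    have h2 : Real.exp (-ρ * τ k) =
        Real.exp (-(ρ - 1 / (2 * ε)) * τ k) * Real.exp (-(1 / (2 * ε)) * τ k) := by
      rw [← Real.exp_add]; ring_nf
    rw [h2] at h1
    refine le_of_mul_le_mul_right (h1.trans (le_of_eq ?_)) (Real.exp_pos (-(1 / (2 * ε)) * τ k))
    ring
  have hlim := (tendsto_exp_mul_atTop_zero (r := -(ρ - 1 / (2 * ε))) (by linarith)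
    ((√(A.eigenvalue 0))⁻¹ * C * ‖w‖)).comp hτlim
  exact hgi (abs_nonpos_iff.1 (ge_of_tendsto' hlim hbound))

theorem phaseMode_real (n : ℕ) (x : ℝ) (c : ℂ) :
    A.phaseMode ε (A.planeMode n n 0) x c = c.re • A.phaseMode ε (A.planeMode n n 0) x 1 := by
  rw [phaseMode_eq, phaseMode_eq, smul_sub, ← restL_apply, ← restL_apply, ← map_smul, ← map_smul,
    ← map_smul]
  simp [planeMode_apply, smul_smul, mul_comm]

theorem phaseMode_one_ne_zero (n : ℕ) (x : ℝ) :
    A.phaseMode ε (A.planeMode n n 0) x 1 ≠ 0 := by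
  intro h
  have h1 := A.coeff_planeMode n n 0 1 n
  have h2 : A.incl (A.planeMode n n 0 1) = A.pos ε (A.phaseMode ε (A.planeMode n n 0) x 1) := rfl
  rw [h2, h, map_zero, A.coeff_zero] at h1
  simp at h1

/-- The first mode has the real rates `x₁ < 0` and `x₂ > 1 / (2 * ε)`. The growing vector is outside
`V`. The other is inside, because `σ < ρ ≤ 1 / (2 * ε) < x₂`. All remaining directions oscillate. -/
theorem hyperbolic_odd (hε : 0 < ε) (hF : ∀ u v, ‖F u - F v‖ ≤ L * ‖u - v‖)
    (hS : A.IsHyperbolicSemigroup ε F S) (hp : A.IsAffineEquilibrium F (A.incl p) K)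
    (hosc : ∀ n, A.IsOscillating ε K (n + 1)) {ν₀ : ℝ} (hν₀ : ν₀ < 0)
    (hmode₀ : A.IsMode K ν₀ (A.planeMode 0 0 0)) {m : ℕ} {ν : ℕ → ℝ}
    (hmode : ∀ n, m ≤ n → A.IsMode K (ν n) (A.planeMode n n 0))
    (hν : ∀ n, m ≤ n → 1 < 4 * ε * ν n) {N : ℕ} {M : Set (A.Energy ε)} (hM : IsNHIM A N S M) :
    Odd N := by
  have hfix : ∀ t, 0 ≤ t → S t (A.rest ε p) = A.rest ε p := fun t ht =>
    A.hyperbolic_fixed hε hF hS hp ht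
  have hmem := hM.1.mem_of_fixed hfix
  have hd : ∀ t, 0 ≤ t → DifferentiableAt ℝ (S t) (A.rest ε p) := fun t ht =>
    hM.2.differentiable t ht _ hmem
  obtain ⟨V, C, ρ, σ, hV, hfd, hN, hρ, hσρ, hinv, hdecay, hfast⟩ := hM.2.normalFibre hmem hfix
  have hρε := A.hyperbolic_decay_rate_le hε hF hS hp hd hmode hν hdecay
  set w := √(1 - 4 * ε * ν₀) with hw
  have hεν : 0 < ε * -ν₀ := mul_pos hε (by linarith)
  have hw2 : w ^ 2 = 1 - 4 * ε * ν₀ := Real.sq_sqrt (by linarith)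
  have hw1 : 1 < w := by
    rw [hw, Real.lt_sqrt zero_le_one]
    linarith
  set x₁ := (1 - w) / (2 * ε) with hx₁
  set x₂ := (1 + w) / (2 * ε) with hx₂
  have h₁ : ε * x₁ ^ 2 - x₁ + ν₀ = 0 := by
    rw [hx₁]; field_simp; linear_combination hw2
  have h₂ : ε * x₂ ^ 2 - x₂ + ν₀ = 0 := by
    rw [hx₂]; field_simp; linear_combination hw2
  have hx₁0 : x₁ ≤ 0 := div_nonpos_of_nonpos_of_nonneg (by linarith) (by linarith)
  have hx₂0 : 1 / (2 * ε) < x₂ := div_lt_div_of_pos_right (by linarith) (by linarith)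
  have hE₁ := fun t ht => A.hyperbolic_fderiv_real hε hF hS hp hmode₀ h₁ ht (hd t ht) 1
  have hE₂ := fun t ht => A.hyperbolic_fderiv_real hε hF hS hp hmode₀ h₂ ht (hd t ht) 1
  have he₁ : A.phaseMode ε (A.planeMode 0 0 0) x₁ 1 ∉ V :=
    not_mem_of_growth (E := fun t => fderiv ℝ (S t) (A.rest ε p)) hρ hdecay hx₁0
      (A.phaseMode_one_ne_zero 0 x₁) hE₁
  have he₂ : A.phaseMode ε (A.planeMode 0 0 0) x₂ 1 ∈ V := by
    refine hfast _ x₂ (by linarith) ⟨‖A.phaseMode ε (A.planeMode 0 0 0) x₂ 1‖, fun t ht => ?_⟩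
    rw [hE₂ t ht, norm_smul, Real.norm_of_nonneg (Real.exp_nonneg _), mul_comm]
  obtain ⟨t, ψ, a, ht, ha, hψ, hℓ⟩ := A.hyperbolic_oscillating_family hε hF hS hp hd hosc
  rw [← hN]
  refine odd_finrank_quotient _ V hV (hinv t ht) ψ a ha hψ he₁ (hE₁ t ht) fun ℓ hℓV hℓ₁ hℓψ => ?_
  have hne : (x₁ : ℂ) ≠ x₂ := by
    rw [Ne, Complex.ofReal_inj]
    intro h
    have : 0 < 1 / (2 * ε) := by positivity
    linarith
  have h0 := A.functional_phaseMode (ℓ := ℓ) hne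
    (fun c => by rw [phaseMode_real, map_smul, hℓ₁, smul_zero])
    (fun c => by rw [phaseMode_real, map_smul, hℓV _ he₂, smul_zero]) 1
  have h1 : A.planeMode 0 0 0 1 = A.basisH1 0 := by simp [planeMode_apply]
  rw [h1, incl_basisH1] at h0
  refine A.energy_functional_eq_zero hε.le (fun n => ?_) fun n => ?_
  · rcases n with _ | n
    · exact h0.1
    · exact (hℓ ℓ hℓψ n).1
  · rcases n with _ | n
    · exact h0.2
    · exact (hℓ ℓ hℓψ n).2

end Hyperbolic

section Parabolic

variable {L : ℝ} {F : H → H} {S : ℝ → A.H1 → A.H1} {p : A.H1} {K : H →L[ℝ] H}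

theorem parabolic_oscillating_family (hF : ∀ u v, ‖F u - F v‖ ≤ L * ‖u - v‖)
    (hS : A.IsParabolicSemigroup F S) (hp : A.IsAffineEquilibrium F (A.incl p) K)
    (hd : ∀ t, 0 ≤ t → DifferentiableAt ℝ (S t) p) {f : ℕ → ℕ}
    (hf : ∀ k, A.IsOscillating 0 K (f k)) :
    ∃ (t : ℝ) (ψ : ℕ → ℂ →ₗ[ℝ] A.H1) (a : ℕ → ℂ), 0 ≤ t ∧ (∀ k, (a k).im ≠ 0) ∧
      (∀ k c, fderiv ℝ (S t) p (ψ k c) = ψ k (a k * c)) ∧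
      ∀ ℓ : A.H1 →L[ℝ] ℝ, (∀ k c, ℓ (ψ k c) = 0) → ∀ k, ℓ (A.basisH1 (f k)) = 0 := by
  choose ν Z hZ hν c hc using hf
  obtain ⟨t, ht, hexp⟩ := exists_time_exp_im_ne_zero (μ := ν)
    fun k => (hν k).im_ne_zero (by simp)
  refine ⟨t, Z, fun i => Complex.exp (-ν i * t), ht.le, hexp,
    fun k c => A.parabolic_fderiv hF hS hp (hZ k) ht.le (hd t ht.le) c, fun ℓ hℓ k => ?_⟩
  rw [← hc]
  exact hℓ k (c k)

theorem parabolic_even (hF : ∀ u v, ‖F u - F v‖ ≤ L * ‖u - v‖)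
    (hS : A.IsParabolicSemigroup F S) (hp : A.IsAffineEquilibrium F (A.incl p) K)
    (hosc : ∀ n, A.IsOscillating 0 K n) {N : ℕ} {M : Set A.H1} (hM : IsNHIM A N S M) :
    Even N := by
  have hfix : ∀ t, 0 ≤ t → S t p = p := fun t ht => A.parabolic_fixed hF hS hp ht
  have hmem := hM.1.mem_of_fixed hfix
  obtain ⟨V, -, -, -, hV, hfd, hN, -, -, hinv, -, -⟩ := hM.2.normalFibre hmem hfix
  obtain ⟨t, ψ, a, ht, ha, hψ, hℓ⟩ := A.parabolic_oscillating_family hF hS hp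
    (fun t ht => hM.2.differentiable t ht _ hmem) hosc
  rw [← hN]
  exact even_finrank_quotient _ V hV (hinv t ht) ψ a ha hψ fun ℓ _ h =>
    A.H1_functional_eq_zero (hℓ ℓ h)

/-- The first mode has only one rate, so no comparison of decay rates is needed. -/
theorem parabolic_odd (hF : ∀ u v, ‖F u - F v‖ ≤ L * ‖u - v‖)
    (hS : A.IsParabolicSemigroup F S) (hp : A.IsAffineEquilibrium F (A.incl p) K)
    (hosc : ∀ n, A.IsOscillating 0 K (n + 1)) {ν₀ : ℝ} (hν₀ : ν₀ < 0)
    (hmode₀ : A.IsMode K ν₀ (A.planeMode 0 0 0)) {N : ℕ} {M : Set A.H1} (hM : IsNHIM A N S M) :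
    Odd N := by
  have hfix : ∀ t, 0 ≤ t → S t p = p := fun t ht => A.parabolic_fixed hF hS hp ht
  have hmem := hM.1.mem_of_fixed hfix
  have hd : ∀ t, 0 ≤ t → DifferentiableAt ℝ (S t) p := fun t ht =>
    hM.2.differentiable t ht _ hmem
  obtain ⟨V, C, ρ, -, hV, hfd, hN, hρ, -, hinv, hdecay, -⟩ := hM.2.normalFibre hmem hfix
  have h1 : A.planeMode 0 0 0 1 = A.basisH1 0 := by simp [planeMode_apply]
  have hE : ∀ t, 0 ≤ t →
      fderiv ℝ (S t) p (A.basisH1 0) = Real.exp (-ν₀ * t) • A.basisH1 0 := by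
    intro t ht
    rw [← h1, A.parabolic_fderiv hF hS hp hmode₀ ht (hd t ht), ← map_smul, Complex.real_smul]
    push_cast
    rfl
  have hne : A.basisH1 0 ≠ 0 := by
    intro h
    have h2 := A.coeff_basis 0 0
    rw [← incl_basisH1, h, map_zero, A.coeff_zero] at h2
    simp at h2
  have he : A.basisH1 0 ∉ V :=
    not_mem_of_growth (E := fun t => fderiv ℝ (S t) p) hρ hdecay hν₀.le hne hE
  obtain ⟨t, ψ, a, ht, ha, hψ, hℓ⟩ := A.parabolic_oscillating_family hF hS hp hd hosc
  rw [← hN]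
  refine odd_finrank_quotient _ V hV (hinv t ht) ψ a ha hψ he (hE t ht) fun ℓ _ hℓ₀ hℓψ =>
    A.H1_functional_eq_zero fun n => ?_
  rcases n with _ | n
  · exact hℓ₀
  · exact hℓ ℓ hℓψ n

end Parabolic

/-- The involution exchanging `2k` and `2k + 1` for the `k` with `P k`. -/
def pairPerm (P : ℕ → Prop) [DecidablePred P] (n : ℕ) : ℕ :=
  if P (n / 2) then (if n % 2 = 0 then n + 1 else n - 1) else n

/-- The weights accompanying `pairPerm`. -/
def pairWeight (P : ℕ → Prop) [DecidablePred P] (a : ℝ) (n : ℕ) : ℝ :=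
  if P (n / 2) ∧ n % 2 = 1 then a else -a

theorem pairPerm_injective (P : ℕ → Prop) [DecidablePred P] :
    Function.Injective (pairPerm P) := by
  refine Function.Involutive.injective fun n => ?_
  unfold pairPerm
  by_cases h : P (n / 2)
  · rcases Nat.mod_two_eq_zero_or_one n with h2 | h2
    · have h3 : (n + 1) / 2 = n / 2 := by omega
      have h4 : (n + 1) % 2 ≠ 0 := by omega
      simp [h, h2, h3, h4]
    · have h3 : (n - 1) / 2 = n / 2 := by omega
      have h4 : (n - 1) % 2 = 0 := by omega
      simp only [h, h2, h3, h4, if_true, one_ne_zero, if_false]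
      omega
  · simp [h]

theorem abs_pairWeight (P : ℕ → Prop) [DecidablePred P] {a : ℝ} (ha : 0 ≤ a) (n : ℕ) :
    |pairWeight P a n| ≤ a := by
  unfold pairWeight
  split_ifs
  · rw [abs_of_nonneg ha]
  · rw [abs_neg, abs_of_nonneg ha]

/-- The offset `o` decides which neighbours are paired. Whether a pair is coupled depends on its
lower eigenvalue alone: if that one satisfies `4 * ε * λ ≥ 1`, so does the upper one, and both
oscillate uncoupled. -/
theorem isOscillating_of_pairPerm {P : ℕ → Prop} [DecidablePred P] {o : ℕ} {a ε : ℝ}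
    {σ : ℕ → ℕ} {s : ℕ → ℝ} {K : H →L[ℝ] H} (ha : 0 < a) (hε : 0 ≤ ε)
    (hgap : ∀ n, 4 * ε * A.eigenvalue n < 1 → A.eigenvalue (n + 1) - A.eigenvalue n < 2 * a)
    (hK : ∀ n u, A.coeff n (K u) = s n * A.coeff (σ n) u) (hσ : Function.Injective σ)
    (hP : ∀ k, P k ↔ 4 * ε * A.eigenvalue (2 * k + o) < 1)
    (hσP : ∀ n, σ (n + o) = pairPerm P n + o) (hsP : ∀ n, s (n + o) = pairWeight P a n) (n : ℕ) :
    A.IsOscillating ε K (n + o) := by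
  by_cases h : P (n / 2)
  · set k := n / 2 with hk
    have e1 : 2 * k / 2 = k := by omega
    have e2 : (2 * k + 1) / 2 = k := by omega
    have e3 : (2 * k + 1) % 2 = 1 := by omega
    have e4 : 2 * k + o + 1 = 2 * k + 1 + o := by omega
    have h1 := isOscillating_pair (ε := ε) hK hσ (n := 2 * k + o) (m := 2 * k + 1 + o) ha
      (by omega) (by rw [hσP]; simp [pairPerm, e1, h])
      (by rw [hσP]; simp [pairPerm, e2, h])
      (by rw [hsP]; simp [pairWeight])
      (by rw [hsP]; simp [pairWeight, e2, e3, h])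
      (A.eigenvalue_mono (by omega)) (by rw [← e4]; exact hgap _ ((hP k).1 h))
    rcases Nat.mod_two_eq_zero_or_one n with h2 | h2
    · have : n = 2 * k := by omega
      rw [this]; exact h1.1
    · have : n = 2 * k + 1 := by omega
      rw [this]; exact h1.2
  · refine isOscillating_single hK hσ ha hε (by rw [hσP]; simp [pairPerm, h])
      (by rw [hsP]; simp [pairWeight, h]) ?_
    rw [hP, not_lt] at h
    exact h.trans (mul_le_mul_of_nonneg_left (A.eigenvalue_mono (by omega)) (by positivity))

end PosOp

end

end

end RelaxedIM

/-- The indices `N` with `4 ε λ_N < 1` are exactly those with `N ≤ n_cr`; the supremum is taken in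
`[-∞, ∞]`, so that it is `-∞` when there is no such index. -/
theorem theorem3p2 {H : Type*} [NormedAddCommGroup H] [InnerProductSpace ℝ H] [CompleteSpace H]
    (A : RelaxedIM.PosOp H) (L ε : ℝ) (hε : 0 ≤ ε)
    (hgap : (⨆ (N : ℕ) (_ : 4 * ε * A.eigenvalue N < 1),
      ((A.eigenvalue (N + 1) - A.eigenvalue N : ℝ) : EReal)) < ((2 * L : ℝ) : EReal))
    (hL : A.eigenvalue 0 < L) :
    ∃ F : H → H, ContDiff ℝ ((⊤ : ℕ∞) : WithTop ℕ∞) F ∧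
      (∀ u₁ u₂ : H, ‖F u₁ - F u₂‖ ≤ L * ‖u₁ - u₂‖) ∧ F 0 = 0 ∧
      ∀ N : ℕ, ¬ RelaxedIM.PossessesNHIM A ε F N := by
  classical
  -- The supremum may be approached without being attained; `b` leaves room for `a < L` with all
  -- relevant gaps below `2 * a`.
  obtain ⟨b, hb, hbL⟩ := EReal.lt_iff_exists_real_btwn.1 hgap
  have hbL' : b < 2 * L := EReal.coe_lt_coe_iff.1 hbL
  set a : ℝ := max (b / 2) ((A.eigenvalue 0 + L) / 2) with ha
  have haL : a < L := max_lt (by linarith) (by linarith)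
  have hla : A.eigenvalue 0 < a := lt_of_lt_of_le (by linarith) (le_max_right _ _)
  have ha0 : 0 < a := (A.eigenvalue_pos 0).trans hla
  have hgap' : ∀ n, 4 * ε * A.eigenvalue n < 1 →
      A.eigenvalue (n + 1) - A.eigenvalue n < 2 * a := by
    intro n hn
    have h1 := (le_iSup₂ (f := fun (N : ℕ) (_ : 4 * ε * A.eigenvalue N < 1) =>
      ((A.eigenvalue (N + 1) - A.eigenvalue N : ℝ) : EReal)) n hn).trans_lt hb
    have h2 := EReal.coe_lt_coe_iff.1 h1
    have h3 := le_max_left (b / 2) ((A.eigenvalue 0 + L) / 2)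
    linarith
  set P₀ : ℕ → Prop := fun k => 4 * ε * A.eigenvalue (2 * k + 0) < 1 with hP₀
  set P₁ : ℕ → Prop := fun k => 4 * ε * A.eigenvalue (2 * k + 1) < 1 with hP₁
  -- Index `0` is fixed with weight `a`; the pairs start at index `1`.
  let σ₁ : ℕ → ℕ := fun n => Nat.casesOn n 0 fun j => RelaxedIM.PosOp.pairPerm P₁ j + 1
  let s₁ : ℕ → ℝ := fun n => Nat.casesOn n a fun j => RelaxedIM.PosOp.pairWeight P₁ a j
  have hσ₁ : Function.Injective σ₁ := by
    rintro (_ | n) (_ | m) h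
    · rfl
    · exact absurd h (Nat.succ_ne_zero _).symm
    · exact absurd h (Nat.succ_ne_zero _)
    · exact congrArg Nat.succ (RelaxedIM.PosOp.pairPerm_injective P₁ (Nat.succ_injective h))
  have hs₁ : ∀ n, |s₁ n| ≤ a := by
    rintro (_ | n)
    · exact (abs_of_pos ha0).le
    · exact RelaxedIM.PosOp.abs_pairWeight P₁ ha0.le n
  have hσ₀ := RelaxedIM.PosOp.pairPerm_injective P₀
  obtain ⟨F, K₀, K₁, R, hsmooth, hlip, hK₀, hK₁, heq₀, heq₁⟩ :=
    A.exists_nonlinearity hla haL hσ₀ hσ₁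
      (RelaxedIM.PosOp.abs_pairWeight P₀ ha0.le) hs₁ rfl rfl
  have hosc₀ : ∀ n, A.IsOscillating ε K₀ n :=
    A.isOscillating_of_pairPerm (o := 0) ha0 hε hgap' hK₀ hσ₀ (fun _ => Iff.rfl)
      (fun _ => rfl) (fun _ => rfl)
  have hosc₁ : ∀ n, A.IsOscillating ε K₁ (n + 1) :=
    A.isOscillating_of_pairPerm (o := 1) ha0 hε hgap' hK₁ hσ₁ (fun _ => Iff.rfl)
      (fun _ => rfl) (fun _ => rfl)
  have hmode₀ := RelaxedIM.PosOp.isMode_single hK₁ hσ₁ (n := 0) rfl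
  have hν₀ : A.eigenvalue 0 - s₁ 0 < 0 := sub_neg.2 hla
  have heq₀' : A.IsAffineEquilibrium F (A.incl (R • A.basisH1 0)) K₀ := by
    rwa [map_smul, RelaxedIM.PosOp.incl_basisH1]
  have heq₁' : A.IsAffineEquilibrium F (A.incl 0) K₁ := by rwa [map_zero]
  refine ⟨F, hsmooth, hlip, ?_, fun N => ?_⟩
  · obtain ⟨r, hr, h⟩ := heq₁
    refine A.coeff_ext fun n => ?_
    simpa using h 0 (by simpa using hr.le) n
  · rintro (⟨hε0, S, hS, M, hM⟩ | ⟨rfl, S, hS, M, hM⟩)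
    · have hε' : 0 < ε := hε.lt_of_ne hε0.symm
      obtain ⟨m, hm⟩ := A.exists_le_eigenvalue (1 / (4 * ε))
      have hlarge : ∀ n, m ≤ n → 1 ≤ 4 * ε * A.eigenvalue n := by
        intro n hn
        have h1 := hm.trans (A.eigenvalue_mono hn)
        rw [div_le_iff₀ (by positivity)] at h1
        linarith
      -- The lower member of a pair may precede `n` by one; the margin `2` keeps it at or beyond
      -- `m`.
      have hfree : ∀ n, m + 2 ≤ n → σ₁ n = n ∧ s₁ n = -a := by
        rintro (_ | n) hn
        · omega
        · have h1 : ¬ P₁ (n / 2) := not_lt.2 (hlarge _ (by omega))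
          constructor
          · change RelaxedIM.PosOp.pairPerm P₁ n + 1 = n + 1
            simp [RelaxedIM.PosOp.pairPerm, h1]
          · change RelaxedIM.PosOp.pairWeight P₁ a n = -a
            simp [RelaxedIM.PosOp.pairWeight, h1]
      have heven := A.hyperbolic_even hε' hlip hS heq₀' hosc₀ hM
      have hodd := A.hyperbolic_odd hε' hlip hS heq₁' hosc₁ hν₀ hmode₀ (m := m + 2)
        (ν := fun n => A.eigenvalue n - s₁ n)
        (fun n hn => RelaxedIM.PosOp.isMode_single hK₁ hσ₁ (hfree n hn).1)
        (fun n hn => by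
          have h1 := hlarge n (by omega)
          have h2 : 0 < ε * a := mul_pos hε' ha0
          rw [(hfree n hn).2]
          linarith) hM
      exact Nat.not_even_iff_odd.2 hodd heven
    · exact Nat.not_even_iff_odd.2 (A.parabolic_odd hlip hS heq₁' hosc₁ hν₀ hmode₀ hM)
        (A.parabolic_even hlip hS heq₀' hosc₀ hM)
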